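/- **Small-liquid-volume spectral bound.** Fix positive material constants: the surface tensions $\sigma,\bar\sigma$, the liquid density $\rho_l$, the liquid viscosity $\mu_l$, the thermal conductivity $\kappa$, specific heat capacity $c$ and specific gas constant $\mathcal R$ of the gas, and put $\gamma=1+\mathcal R/c$. For a temperature $T>0$, a gas mass $M>0$ and a liquid volume $V>0$ let $\bar V=3V/4\pi$ and let $(\rho_\dagger,R_\dagger)$ be the unique pair of positive numbers with $$\frac{4\pi}{3}\rho_\dagger R_\dagger^3=M,\qquad \rho_\dagger=\frac{2}{\mathcal R T}\Big(\frac{\sigma}{R_\dagger}+\frac{\bar\sigma}{\bar R_\dagger}\Big),\qquad \bar R_\dagger=(R_\dagger^3+\bar V)^{1/3}.$$ Put $\bar\kappa=\kappa/(R_\dagger^2\rho_\dagger\gamma c)$, $\tilde R=R_\dagger-R_\dagger^2/\bar R_\dagger$, $a=3\gamma\rho_\dagger/R_\dagger$ and, for $k\ge1$, $$c_k=\frac{(-1)^{k-1}2^{3/2}(\gamma-1)}{\sqrt\pi\,\gamma k},\qquad \omega_k=-\frac{R_\dagger\bar\kappa}{\rho_\dagger}\sqrt{\frac{\pi}{2}}\,(-1)^kk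 .$$ Let $\mathcal L=\mathcal L_{T,M,V}$ be the operator on the complex Hilbert space $\ell^2$, with its maximal domain (the $z\in\ell^2$ for which the series below converges absolutely and the image lies in $\ell^2$), that maps $z=(\varrho,r,v,\theta_1,\theta_2,\dots)$ to the sequence with the entries $$a\Big(\sum_j\omega_j\theta_j-v\Big),\qquad v,\qquad \frac{1}{\rho_l\tilde R}\Big[\mathcal R T\,\varrho+\Big(\frac{2\sigma}{R_\dagger^2}+\frac{2\bar\sigma R_\dagger^2}{\bar R_\dagger^4}\Big)r-\frac{4\mu_l\bar V}{R_\dagger(R_\dagger^3+\bar V)}v\Big],$$ $$-\pi^2k^2\bar\kappa\,\theta_k-c_ka\Big(\sum_j\omega_j\theta_j-v\Big)\qquad(k\ge1).$$ Let $s(T,M,V)=\sup\{\operatorname{Re}\lambda:\lambda\in\operatorname{sp}(\mathcal L)\setminus\{0\}\}$. 1. There is $\Theta_0\in(0,1)$, independent of $T$, $M$ and $V$, such that for all $T,M>0$ there is $V_0>0$ such that for every $V\in(0,V_0)$ the set $\{\operatorname{Re}\lambda:\lambda\in\operatorname{sp}(\mathcal L)\setminus\{0\}\}$ is nonempty and bounded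 above, and $$-\pi^2\bar\kappa<s(T,M,V)\le-\Theta_0\pi^2\bar\kappa .$$ 2. For all $T,M,V>0$, $$\frac{\kappa\pi^2}{\gamma c}\sqrt{\frac{2\pi\mathcal R}{3\sigma}}\;\frac{\sqrt{T/M}}{\sqrt{1+\bar\sigma/\sigma}}<\pi^2\bar\kappa<\frac{\kappa\pi^2}{\gamma c}\sqrt{\frac{2\pi\mathcal R}{3\sigma}}\;\sqrt{\frac TM}.$$ 3. For small liquid volumes a smaller gas mass or a higher temperature gives a faster decay rate $-s$: if $0<T\le T'$ and $0<M'\le M$, and at least one of $T<T'$, $M'<M$ holds, then there is $V_0>0$ such that $s(T',M',V)<s(T,M,V)$ for every $V\in(0,V_0)$. -/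

import Mathlib

noncomputable section

namespace BubbleSpectrum

/-! ### Unbounded operators on `ℓ²`: matrix operators and their spectrum -/

/-- The complex Hilbert space of square-summable families indexed by `ι`. -/
abbrev ellTwo (ι : Type) : Type := lp (fun _ : ι => ℂ) 2

/-- The maximal domain of the operator on `ℓ²` given by an infinite matrix `a`: those `z ∈ ℓ²` for
which every row sum converges and the resulting family is again in `ℓ²`. -/
def matrixDomain {ι : Type} (a : ι → ι → ℂ) : Submodule ℂ (ellTwo ι) where
  carrier := {z | (∀ i, Summable fun j => a i j * z j) ∧
    Memℓp (fun i => ∑' j, a i j * z j) 2}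
  zero_mem' := by
    refine ⟨fun i => by simp [summable_zero], ?_⟩
    have h : (fun i => ∑' j, a i j * (0 : ellTwo ι) j) = 0 := by funext i; simp
    rw [h]; exact zero_memℓp
  add_mem' := by
    rintro x y ⟨hx, hx'⟩ ⟨hy, hy'⟩
    have hs : ∀ i, (fun j => a i j * (x + y) j) = fun j => a i j * x j + a i j * y j := by
      intro i; funext j; simp [mul_add]
    refine ⟨fun i => by rw [hs i]; exact (hx i).add (hy i), ?_⟩
    have : (fun i => ∑' j, a i j * (x + y) j)
        = (fun i => ∑' j, a i j * x j) + fun i => ∑' j, a i j * y j := by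
      funext i; rw [hs i]; exact (hx i).tsum_add (hy i)
    rw [this]; exact hx'.add hy'
  smul_mem' := by
    rintro c x ⟨hx, hx'⟩
    have hs : ∀ i, (fun j => a i j * (c • x) j) = fun j => c * (a i j * x j) := by
      intro i; funext j; simp [mul_left_comm]
    refine ⟨fun i => by rw [hs i]; exact (hx i).mul_left c, ?_⟩
    have : (fun i => ∑' j, a i j * (c • x) j) = c • fun i => ∑' j, a i j * x j := by
      funext i; rw [hs i, tsum_mul_left]; rfl
    rw [this]; exact hx'.const_smul c

/-- The (in general unbounded) operator `z ↦ (∑ⱼ aᵢⱼ zⱼ)ᵢ` on `ℓ²`, on its maximal domain. -/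
def matrixOperator {ι : Type} (a : ι → ι → ℂ) : ellTwo ι →ₗ.[ℂ] ellTwo ι where
  domain := matrixDomain a
  toFun :=
    { toFun := fun z => ⟨fun i => ∑' j, a i j * (z : ellTwo ι) j, z.2.2⟩
      map_add' := by
        intro x y
        ext i
        have : (fun j => a i j * ((x : ellTwo ι) + (y : ellTwo ι)) j)
            = fun j => a i j * (x : ellTwo ι) j + a i j * (y : ellTwo ι) j := by
          funext j; simp [mul_add]
        change ∑' j, a i j * ((x : ellTwo ι) + (y : ellTwo ι)) j = _
        rw [this]
        exact (x.2.1 i).tsum_add (y.2.1 i)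
      map_smul' := by
        intro c x
        ext i
        have : (fun j => a i j * (c • (x : ellTwo ι)) j)
            = fun j => c * (a i j * (x : ellTwo ι) j) := by
          funext j; simp [mul_left_comm]
        change ∑' j, a i j * (c • (x : ellTwo ι)) j = _
        rw [this, tsum_mul_left]
        rfl }

/-- `lam` lies in the resolvent set of the operator `A` if `A - lam`, from the domain of `A` to the
whole space, has a bounded everywhere defined two-sided inverse. -/
def IsResolventPoint {E : Type*} [NormedAddCommGroup E] [NormedSpace ℂ E]
    (A : E →ₗ.[ℂ] E) (lam : ℂ) : Prop :=
  ∃ S : E →L[ℂ] E,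
    (∀ w : E, ∃ h : S w ∈ A.domain, A ⟨S w, h⟩ - lam • S w = w) ∧
    ∀ z : A.domain, S (A z - lam • (z : E)) = z

/-- The spectrum of a (possibly unbounded) operator: the complement of its resolvent set. -/
def opSpectrum {E : Type*} [NormedAddCommGroup E] [NormedSpace ℂ E]
    (A : E →ₗ.[ℂ] E) : Set ℂ :=
  {lam | ¬ IsResolventPoint A lam}

/-! ### The physical constants and the equilibrium -/

/-- The fixed material constants, all positive. -/
structure Medium where
  /-- surface tension of the gas-liquid interface -/
  sigma : ℝ
  /-- surface tension of the external free surface -/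
  sigmaBar : ℝ
  /-- liquid density -/
  rhoL : ℝ
  /-- dynamic viscosity of the liquid -/
  muL : ℝ
  /-- thermal conductivity of the gas -/
  kTh : ℝ
  /-- specific heat capacity of the gas -/
  cHeat : ℝ
  /-- specific gas constant -/
  rGas : ℝ
  sigma_pos : 0 < sigma
  sigmaBar_pos : 0 < sigmaBar
  rhoL_pos : 0 < rhoL
  muL_pos : 0 < muL
  kTh_pos : 0 < kTh
  cHeat_pos : 0 < cHeat
  rGas_pos : 0 < rGas

/-- The adiabatic constant `γ = 1 + 𝓡 / c`. -/
def Medium.gamma (m : Medium) : ℝ := 1 + m.rGas / m.cHeat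

/-- The modified liquid volume `3V / 4π`. -/
def volBar (V : ℝ) : ℝ := 3 * V / (4 * Real.pi)

/-- The external radius `(R³ + 3V/4π)^{1/3}` belonging to the bubble radius `R`. -/
def outerRadius (V R : ℝ) : ℝ := (R ^ 3 + volBar V) ^ (1 / 3 : ℝ)

/-- `(ρ, R)` is the density and radius of a spherically symmetric equilibrium with external
temperature `T`, gas mass `M` and liquid volume `V`. -/
def Medium.IsEquilibrium (m : Medium) (T M V ρ R : ℝ) : Prop :=
  0 < ρ ∧ 0 < R ∧ 4 * Real.pi / 3 * ρ * R ^ 3 = M ∧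
    ρ = 2 / (m.rGas * T) * (m.sigma / R + m.sigmaBar / outerRadius V R)

lemma outerRadius_pos {V R : ℝ} (hV : 0 < V) (hR : 0 < R) : 0 < outerRadius V R := by
  unfold outerRadius volBar
  positivity

/-- The ratio of inner to outer radius is nondecreasing in the inner radius. -/
lemma div_outerRadius_mono {V R S : ℝ} (hV : 0 < V) (hR : 0 < R) (hRS : R ≤ S) :
    R / outerRadius V R ≤ S / outerRadius V S := by
  have hS : 0 < S := hR.trans_le hRS
  have hb : 0 < volBar V := by unfold volBar; positivity
  have key : ∀ X : ℝ, 0 < X → X / outerRadius V X = (X ^ 3 / (X ^ 3 + volBar V)) ^ (1 / 3 : ℝ) := by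
    intro X hX
    rw [Real.div_rpow (by positivity) (by positivity), ← Real.rpow_natCast X 3,
      ← Real.rpow_mul hX.le]
    norm_num [outerRadius]
  rw [key R hR, key S hS]
  have h3 : R ^ 3 ≤ S ^ 3 := by gcongr
  refine Real.rpow_le_rpow (by positivity) ?_ (by norm_num)
  rw [div_le_div_iff₀ (by positivity) (by positivity)]
  nlinarith

/-- For all positive `T, M, V` there is exactly one equilibrium. -/
theorem Medium.existsUnique_equilibrium (m : Medium) {T M V : ℝ}
    (hT : 0 < T) (hM : 0 < M) (hV : 0 < V) :
    ∃! x : ℝ × ℝ, m.IsEquilibrium T M V x.1 x.2 := by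
  have hσ := m.sigma_pos
  have hσ' := m.sigmaBar_pos
  have hg := m.rGas_pos
  have hb : 0 < volBar V := by unfold volBar; positivity
  -- the mass as a function of the radius, up to a positive factor
  set f : ℝ → ℝ := fun R => R ^ 2 * (m.sigma + m.sigmaBar * (R / outerRadius V R)) with hf
  set K : ℝ := 8 * Real.pi / (3 * (m.rGas * T)) with hK
  have hKpos : 0 < K := by rw [hK]; positivity
  have hmass : ∀ R : ℝ, 0 < R →
      4 * Real.pi / 3 * (2 / (m.rGas * T) * (m.sigma / R + m.sigmaBar / outerRadius V R)) * R ^ 3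
        = K * f R := by
    intro R hR
    have ho := outerRadius_pos hV hR
    simp only [hf, hK]
    field_simp
    ring
  have hmono : ∀ R S : ℝ, 0 < R → R < S → f R < f S := by
    intro R S hR hRS
    have hS := hR.trans hRS
    have h1 := div_outerRadius_mono hV hR hRS.le
    have h0 : 0 < R / outerRadius V R := div_pos hR (outerRadius_pos hV hR)
    simp only [hf]
    have h2 : R ^ 2 < S ^ 2 := by gcongr
    have h3 : m.sigma + m.sigmaBar * (R / outerRadius V R)
        ≤ m.sigma + m.sigmaBar * (S / outerRadius V S) := by gcongr
    exact mul_lt_mul h2 h3 (by positivity) (by positivity)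
  have hex : ∃ R : ℝ, 0 < R ∧ K * f R = M := by
    set b : ℝ := Real.sqrt (M / (K * m.sigma)) with hbdef
    have hbpos : 0 < b := Real.sqrt_pos.mpr (by positivity)
    have hcont : ContinuousOn (fun R => K * f R) (Set.Icc 0 b) := by
      have ho : ContinuousOn (fun R : ℝ => outerRadius V R) (Set.Icc 0 b) := by
        unfold outerRadius
        refine ContinuousOn.rpow_const (by fun_prop) ?_
        intro x hx
        left
        have := hx.1
        positivity
      have hne : ∀ x ∈ Set.Icc 0 b, outerRadius V x ≠ 0 := by
        intro x hx
        have := hx.1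
        unfold outerRadius
        positivity
      simp only [hf]
      refine continuousOn_const.mul (ContinuousOn.mul (by fun_prop)
        (continuousOn_const.add (continuousOn_const.mul (continuousOn_id.div ho hne))))
    have h0 : K * f 0 ≤ M := by simp [hf]; exact hM.le
    have h1 : M ≤ K * f b := by
      have hq : 0 < b / outerRadius V b := div_pos hbpos (outerRadius_pos hV hbpos)
      have hb2 : b ^ 2 = M / (K * m.sigma) := Real.sq_sqrt (by positivity)
      have : K * (b ^ 2 * m.sigma) = M := by rw [hb2]; field_simp
      have h2 : b ^ 2 * m.sigma ≤ f b := by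
        simp only [hf]
        have : 0 ≤ m.sigmaBar * (b / outerRadius V b) := by positivity
        gcongr
        linarith
      calc M = K * (b ^ 2 * m.sigma) := this.symm
        _ ≤ K * f b := by gcongr
    obtain ⟨R, hR, hRM⟩ := intermediate_value_Icc hbpos.le hcont ⟨h0, h1⟩
    refine ⟨R, lt_of_le_of_ne hR.1 ?_, hRM⟩
    rintro rfl
    simp [hf] at hRM
    exact hM.ne hRM
  obtain ⟨R, hR, hRM⟩ := hex
  have ho := outerRadius_pos hV hR
  refine ⟨(2 / (m.rGas * T) * (m.sigma / R + m.sigmaBar / outerRadius V R), R),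
    ⟨by positivity, hR, by rw [hmass R hR, hRM], rfl⟩, ?_⟩
  rintro ⟨ρ, S⟩ ⟨-, hS, h1, h2⟩
  simp only at hS h1 h2
  rw [h2, hmass S hS, ← hRM] at h1
  have hfe : f S = f R := mul_left_cancel₀ hKpos.ne' h1
  have hSR : S = R := by
    rcases lt_trichotomy S R with h | h | h
    · exact absurd hfe (hmono S R hS h).ne
    · exact h
    · exact absurd hfe (hmono R S hR h).ne'
  subst hSR
  rw [h2]

/-- The equilibrium `(ρ†, R†)` determined by `T, M, V`. -/
def Medium.equilibrium (m : Medium) (T M V : ℝ) : ℝ × ℝ :=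
  Classical.epsilon fun x : ℝ × ℝ => m.IsEquilibrium T M V x.1 x.2

/-- The equilibrium gas density `ρ†[M,V]`. -/
def Medium.rhoEq (m : Medium) (T M V : ℝ) : ℝ := (m.equilibrium T M V).1

/-- The equilibrium gas radius `R†[M,V]`. -/
def Medium.rEq (m : Medium) (T M V : ℝ) : ℝ := (m.equilibrium T M V).2

theorem Medium.isEquilibrium_eq (m : Medium) {T M V : ℝ}
    (hT : 0 < T) (hM : 0 < M) (hV : 0 < V) :
    m.IsEquilibrium T M V (m.rhoEq T M V) (m.rEq T M V) :=
  Classical.epsilon_spec (p := fun x : ℝ × ℝ => m.IsEquilibrium T M V x.1 x.2)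
    (m.existsUnique_equilibrium hT hM hV).exists

/-- The equilibrium external radius. -/
def Medium.rOutEq (m : Medium) (T M V : ℝ) : ℝ := outerRadius V (m.rEq T M V)

/-! ### The linearized operator -/

/-- `κ̄ = k / (R†² ρ† γ c)`. -/
def Medium.kappaBar (m : Medium) (T M V : ℝ) : ℝ :=
  m.kTh / (m.rEq T M V ^ 2 * m.rhoEq T M V * m.gamma * m.cHeat)

/-- `R† - R†² / R̄†`. -/
def Medium.rTilde (m : Medium) (T M V : ℝ) : ℝ :=
  m.rEq T M V - m.rEq T M V ^ 2 / m.rOutEq T M V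

/-- `c_k = (-1)^(k-1) 2^(3/2) (γ - 1) / (√π γ k)`, written for `k = n + 1`. -/
def Medium.coeff (m : Medium) (n : ℕ) : ℝ :=
  (-1) ^ n * (2 * Real.sqrt 2) * (m.gamma - 1) / (Real.sqrt Real.pi * m.gamma * ((n : ℝ) + 1))

/-- `ω_k = -(R† κ̄ / ρ†) √(π/2) (-1)^k k`, written for `k = n + 1`. -/
def Medium.omega (m : Medium) (T M V : ℝ) (n : ℕ) : ℝ :=
  -(m.rEq T M V * m.kappaBar T M V / m.rhoEq T M V) * Real.sqrt (Real.pi / 2) *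
    (-1) ^ (n + 1) * ((n : ℝ) + 1)

/-- The radial Dirichlet eigenvalue `(kπ)²` of the unit ball, written for `k = n + 1`. -/
def eigval (n : ℕ) : ℝ := (((n : ℝ) + 1) * Real.pi) ^ 2

/-- The infinite matrix of the linearized operator. The indices `inl 0, inl 1, inl 2` stand for the
perturbations of the boundary density, the radius and the velocity of the radius, and `inr n` for
the coefficient of the `(n+1)`-st radial Dirichlet eigenfunction. -/
def Medium.entry (m : Medium) (T M V : ℝ) : Fin 3 ⊕ ℕ → Fin 3 ⊕ ℕ → ℝ
  | .inl i, .inl j =>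
      !![0, 0, -(3 * m.gamma * m.rhoEq T M V / m.rEq T M V);
         0, 0, 1;
         m.rGas * T / (m.rhoL * m.rTilde T M V),
         (2 * m.sigma * m.rOutEq T M V ^ 4 + 2 * m.sigmaBar * m.rEq T M V ^ 4) /
           (m.rhoL * m.rTilde T M V * m.rEq T M V ^ 2 * m.rOutEq T M V ^ 4),
         -4 * m.muL * volBar V /
           (m.rhoL * m.rTilde T M V * m.rEq T M V * (m.rEq T M V ^ 3 + volBar V))] i j
  | .inl i, .inr n =>
      ![m.omega T M V n * (3 * m.gamma * m.rhoEq T M V / m.rEq T M V), 0, 0] i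
  | .inr n, .inl j =>
      ![0, 0, m.coeff n * (3 * m.gamma * m.rhoEq T M V / m.rEq T M V)] j
  | .inr n, .inr l =>
      -(m.coeff n * m.omega T M V l * (3 * m.gamma * m.rhoEq T M V / m.rEq T M V)) -
        if n = l then m.kappaBar T M V * eigval n else 0

/-- The linearized operator `𝓛` on `ℓ²`. -/
def Medium.linOp (m : Medium) (T M V : ℝ) :
    ellTwo (Fin 3 ⊕ ℕ) →ₗ.[ℂ] ellTwo (Fin 3 ⊕ ℕ) :=
  matrixOperator fun i j => ((m.entry T M V i j : ℝ) : ℂ)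

/-- `{Re λ : λ ∈ sp(𝓛) \ {0}}`. -/
def Medium.reSpectrum (m : Medium) (T M V : ℝ) : Set ℝ :=
  Complex.re '' (opSpectrum (m.linOp T M V) \ {0})

end BubbleSpectrum

end

noncomputable section

namespace BubbleSpectrum

/-! ### The bordered diagonal operator -/

/-! The operator is diagonal up to three extra coordinates and the single scalar coupling `s = ∑ ωₖ
θₖ`. For `λ ≠ 0` away from the diagonal values, `𝓛 z - λ z = w` can be solved by hand and reduces to
a scalar equation with determinant `F = G (b₂ - b₃ λ - λ²) - b₁ a`, where `G = 1 + a ∑ ωₖ cₖ / (dₖ +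
λ)`. A zero of `F` is an eigenvalue (`not_isResolventPoint_bubble`); where `F` and `G` do not
vanish, a bounded inverse can be written down (`isResolventPoint_bubble`).

The product `ωₖ cₖ` does not depend on `k`. With `λ = κ̄ x` the equation `F = 0` becomes `thermal γ
x * (1 - δ x - ε x²) = A` (`Medium.mem_opSpectrum_iff`), valid for `Re x > -π²`, where `G` never
vanishes. As `V → 0` the ratio `q = R† / R̄†` tends to `1`, so `ε, δ → 0` and `A → 3γ` with `A ≥
3γ`. The limit equation `thermal γ x = 3γ` involves only `γ`; on the real interval `(-π², 0]` its
left side decreases from `+∞` to `γ`, which gives a root `u < 0`.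

The real root survives the perturbation by the intermediate value theorem. The danger lies in
non-real roots, because `ε x²` is a singular perturbation. `exists_forall_nonreal_ne` excludes them:
the imaginary part of the equation forces `∑ |π² k² + x|⁻² = O(ε)` and its size forces `|x|² =
O(1/ε)`, whereas the first `N` terms of the sum already contribute a multiple of `N ε`, with `N` at
choice.

Hence `s / κ̄` is close to `u` (`Medium.eventually_spectralBound`). Assertions 1 and 3 follow from
this and from the limit of `κ̄`; assertion 2 holds because `κ̄` is an explicit decreasing function
of `q ∈ (0, 1)`. -/

/-- The matrix of the linearized operator with abstract coefficients: a `3 × 3` block coupled to a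
diagonal matrix `-d` through rank-one terms. -/
def bubbleMatrix (a b₁ b₂ b₃ : ℂ) (c ω d : ℕ → ℂ) : Fin 3 ⊕ ℕ → Fin 3 ⊕ ℕ → ℂ
  | .inl i, .inl j => !![0, 0, -a; 0, 0, 1; b₁, b₂, -b₃] i j
  | .inl i, .inr n => ![ω n * a, 0, 0] i
  | .inr n, .inl j => ![0, 0, c n * a] j
  | .inr n, .inr l => -(c n * ω l * a) - if n = l then d n else 0

/-- The value of the operator with matrix `bubbleMatrix`, in terms of the coordinates and of the
coupling sum `s = ∑ ωₙ zₙ`. -/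
def bubbleAction (a b₁ b₂ b₃ : ℂ) (c d : ℕ → ℂ) (s : ℂ) (z : Fin 3 ⊕ ℕ → ℂ) : Fin 3 ⊕ ℕ → ℂ
  | .inl i => ![a * (s - z (.inl 2)), z (.inl 2),
      b₁ * z (.inl 0) + b₂ * z (.inl 1) - b₃ * z (.inl 2)] i
  | .inr n => -(d n * z (.inr n)) - c n * (a * (s - z (.inl 2)))

variable {a b₁ b₂ b₃ lam g : ℂ} {c ω d : ℕ → ℂ}

/-- All infinite rows have a tail proportional to `ω`, up to one diagonal term, so convergence of
the one series `∑ ωₙ zₙ` controls every row at once. -/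
lemma hasSum_bubbleMatrix {z : Fin 3 ⊕ ℕ → ℂ} {s : ℂ}
    (hs : HasSum (fun n => ω n * z (.inr n)) s) (i : Fin 3 ⊕ ℕ) :
    HasSum (fun j => bubbleMatrix a b₁ b₂ b₃ c ω d i j * z j)
      (bubbleAction a b₁ b₂ b₃ c d s z i) := by
  rcases i with i | n
  · have h1 := hasSum_fintype fun j : Fin 3 =>
      bubbleMatrix a b₁ b₂ b₃ c ω d (.inl i) (.inl j) * z (.inl j)
    have h2 : HasSum (fun n => bubbleMatrix a b₁ b₂ b₃ c ω d (.inl i) (.inr n) * z (.inr n))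
        (![a * s, 0, 0] i) := by
      fin_cases i
      · simpa [bubbleMatrix, mul_assoc, mul_left_comm] using hs.mul_left a
      · simp [bubbleMatrix]
      · simp [bubbleMatrix]
    convert HasSum.sum (f := fun j => bubbleMatrix a b₁ b₂ b₃ c ω d (.inl i) j * z j) h1 h2 using 1
    fin_cases i <;> simp [bubbleAction, bubbleMatrix, Fin.sum_univ_three] <;> ring
  · have h1 := hasSum_fintype fun j : Fin 3 =>
      bubbleMatrix a b₁ b₂ b₃ c ω d (.inr n) (.inl j) * z (.inl j)
    have h2 : HasSum (fun l => bubbleMatrix a b₁ b₂ b₃ c ω d (.inr n) (.inr l) * z (.inr l))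
        (-(c n * a) * s - d n * z (.inr n)) := by
      have h3 : HasSum (fun l => (if n = l then d n else 0) * z (.inr l)) (d n * z (.inr n)) := by
        convert hasSum_ite_eq n (d n * z (.inr n)) using 2 with l
        by_cases h : n = l
        · simp [h]
        · simp [h, Ne.symm h]
      refine ((hs.mul_left (-(c n * a))).sub h3).congr_fun ?_
      intro l
      simp only [bubbleMatrix]
      ring
    convert HasSum.sum (f := fun j => bubbleMatrix a b₁ b₂ b₃ c ω d (.inr n) j * z j) h1 h2 using 1
    simp [bubbleAction, bubbleMatrix, Fin.sum_univ_three]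
    ring

/-- The tail of the first row is `a ω`, so absolute convergence in that row already yields the
coupling sum. -/
lemma summable_of_mem_matrixDomain (ha : a ≠ 0) {z : ellTwo (Fin 3 ⊕ ℕ)}
    (hz : z ∈ matrixDomain (bubbleMatrix a b₁ b₂ b₃ c ω d)) :
    Summable fun n => ω n * z (.inr n) := by
  have h := ((hz.1 (.inl 0)).comp_injective Sum.inr_injective).mul_left a⁻¹
  refine h.congr fun n => ?_
  simp [bubbleMatrix]
  field_simp

lemma mem_matrixDomain_of_hasSum {z : ellTwo (Fin 3 ⊕ ℕ)} {s : ℂ}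
    (hs : HasSum (fun n => ω n * z (.inr n)) s)
    (hz : Memℓp (bubbleAction a b₁ b₂ b₃ c d s z) 2) :
    z ∈ matrixDomain (bubbleMatrix a b₁ b₂ b₃ c ω d) := by
  refine ⟨fun i => (hasSum_bubbleMatrix hs i).summable, ?_⟩
  simpa only [(hasSum_bubbleMatrix hs _).tsum_eq] using hz

lemma matrixOperator_bubbleMatrix_apply
    (z : (matrixOperator (bubbleMatrix a b₁ b₂ b₃ c ω d)).domain) {s : ℂ}
    (hs : HasSum (fun n => ω n * (z : ellTwo (Fin 3 ⊕ ℕ)) (.inr n)) s) (i : Fin 3 ⊕ ℕ) :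
    matrixOperator (bubbleMatrix a b₁ b₂ b₃ c ω d) z i =
      bubbleAction a b₁ b₂ b₃ c d s (z : ellTwo (Fin 3 ⊕ ℕ)) i :=
  (hasSum_bubbleMatrix hs i).tsum_eq

lemma ellTwo_add_apply {ι : Type} (x y : ellTwo ι) (i : ι) : (x + y) i = x i + y i := rfl

lemma ellTwo_smul_apply {ι : Type} (k : ℂ) (x : ellTwo ι) (i : ι) : (k • x) i = k * x i := rfl

/-- Extension by zero preserves square summability. -/
lemma memℓp_sumElim_zero {h : ℕ → ℂ} (hh : Memℓp h 2) :
    Memℓp (Sum.elim (fun _ => 0) h : Fin 3 ⊕ ℕ → ℂ) 2 := by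
  have h2 : (0 : ℝ) < (2 : ENNReal).toReal := by norm_num
  refine memℓp_gen (Summable.sum _ ?_ ?_)
  · exact (hasSum_fintype _).summable
  · exact hh.summable h2

/-- A square summable family represents a bounded functional. -/
lemma exists_functional {h : ℕ → ℂ} (hh : Memℓp h 2) :
    ∃ f : ellTwo (Fin 3 ⊕ ℕ) →L[ℂ] ℂ, ∀ w, HasSum (fun n => h n * w (.inr n)) (f w) := by
  -- The entries are conjugated because the inner product is conjugate-linear in its first slot.
  let H : ellTwo (Fin 3 ⊕ ℕ) := ⟨_, (memℓp_sumElim_zero hh).star_mem⟩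
  refine ⟨innerSL (E := ellTwo (Fin 3 ⊕ ℕ)) ℂ H, fun w => ?_⟩
  have h1 := lp.hasSum_inner (𝕜 := ℂ) (G := fun _ : Fin 3 ⊕ ℕ => ℂ) H w
  rw [← Function.Injective.hasSum_iff Sum.inr_injective] at h1
  · refine h1.congr_fun fun n => ?_
    simp [H, mul_comm]
  · rintro (i | n) hi
    · simp [H]
    · exact absurd ⟨n, rfl⟩ hi

/-- A zero of the characteristic function is an eigenvalue. -/
theorem not_isResolventPoint_bubble (ha : a ≠ 0) (hlam : lam ≠ 0) (hne : ∀ n, d n + lam ≠ 0)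
    (he : Memℓp (fun n => c n / (d n + lam)) 2)
    (hg : HasSum (fun n => ω n * (c n / (d n + lam))) g)
    (hF : (1 + a * g) * (b₂ - b₃ * lam - lam ^ 2) - b₁ * a = 0) :
    ¬ IsResolventPoint (matrixOperator (bubbleMatrix a b₁ b₂ b₃ c ω d)) lam := by
  rintro ⟨S, -, hS⟩
  let z : ellTwo (Fin 3 ⊕ ℕ) := ⟨Sum.elim (fun _ => 0) fun n => c n / (d n + lam),
      memℓp_sumElim_zero he⟩
  have zl : ∀ i, z (.inl i) = 0 := fun _ => rfl
  have zr : ∀ n, z (.inr n) = c n / (d n + lam) := fun _ => rfl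
  -- The eigenvector, normalised by `λ ϱ = -a`: the tail rows then give `θₙ = a cₙ / (dₙ + λ)` with
  -- coupling sum `a g`, the first row gives `v = 1 + a g`, the second `r = v / λ`, and the third is
  -- exactly `hF`.
  let y : ellTwo (Fin 3 ⊕ ℕ) := a • z + lp.single 2 (.inl 0) (-a / lam) +
    lp.single 2 (.inl 1) ((1 + a * g) / lam) + lp.single 2 (.inl 2) (1 + a * g)
  have y0 : y (.inl 0) = -a / lam := by simp [y, zl, ellTwo_add_apply, ellTwo_smul_apply]
  have y1 : y (.inl 1) = (1 + a * g) / lam := by simp [y, zl, ellTwo_add_apply, ellTwo_smul_apply]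
  have y2 : y (.inl 2) = 1 + a * g := by simp [y, zl, ellTwo_add_apply, ellTwo_smul_apply]
  have yn : ∀ n, y (.inr n) = a * (c n / (d n + lam)) := by intro n; simp [y, zr, ellTwo_add_apply, ellTwo_smul_apply]
  have hs : HasSum (fun n => ω n * y (.inr n)) (a * g) := by
    refine (hg.mul_left a).congr_fun fun n => ?_
    rw [yn]; ring
  have hact : bubbleAction a b₁ b₂ b₃ c d (a * g) y = lam • y := by
    funext i
    rcases i with i | n
    · fin_cases i
      · simp [bubbleAction, y0, y2]; field_simp
      · simp [bubbleAction, y1, y2]; field_simp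
      · simp [bubbleAction, y0, y1, y2]
        field_simp
        linear_combination hF
    · have := hne n
      simp [bubbleAction, y2, yn]
      field_simp
      ring
  have hy : y ∈ matrixDomain (bubbleMatrix a b₁ b₂ b₃ c ω d) :=
    mem_matrixDomain_of_hasSum hs (by rw [hact]; exact (lam • y).2)
  have h0 : matrixOperator (bubbleMatrix a b₁ b₂ b₃ c ω d) ⟨y, hy⟩ - lam • y = 0 := by
    ext i
    have := matrixOperator_bubbleMatrix_apply ⟨y, hy⟩ hs i
    simp only [lp.coeFn_sub, Pi.sub_apply, this, hact]
    simp
  have h1 := hS ⟨y, hy⟩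
  rw [h0, map_zero] at h1
  have h2 : y (.inl 0) = 0 := by
    have h3 : y = 0 := h1.symm
    simp [h3]
  rw [y0] at h2
  simp [ha, hlam] at h2

/-- Away from the zeros of the characteristic function and from the diagonal, `lam` is a resolvent
point. -/
theorem isResolventPoint_bubble (ha : a ≠ 0) (hlam : lam ≠ 0) {K : ℝ}
    (hK : ∀ n, ‖(d n + lam)⁻¹‖ ≤ K) (hne : ∀ n, d n + lam ≠ 0)
    (he : Memℓp (fun n => c n / (d n + lam)) 2) (hh : Memℓp (fun n => ω n / (d n + lam)) 2)
    (hg : HasSum (fun n => ω n * (c n / (d n + lam))) g) (hG : 1 + a * g ≠ 0)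
    (hF : (1 + a * g) * (b₂ - b₃ * lam - lam ^ 2) - b₁ * a ≠ 0) :
    IsResolventPoint (matrixOperator (bubbleMatrix a b₁ b₂ b₃ c ω d)) lam := by
  have hK0 : 0 ≤ K := (norm_nonneg _).trans (hK 0)
  set G := 1 + a * g with hGdef
  set F := G * (b₂ - b₃ * lam - lam ^ 2) - b₁ * a with hFdef
  obtain ⟨l, hl⟩ := exists_functional hh
  let e : ellTwo (Fin 3 ⊕ ℕ) := ⟨Sum.elim (fun _ => 0) fun n => c n / (d n + lam),
      memℓp_sumElim_zero he⟩
  let ev : Fin 3 → (ellTwo (Fin 3 ⊕ ℕ) →L[ℂ] ℂ) := fun i =>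
    lp.evalCLM ℂ (fun _ : Fin 3 ⊕ ℕ => ℂ) 2 (.inl i)
  -- `fv` and `fp` are the values of `v` and of `a (s - v)` in the solution of `𝓛 z - λ z = w`.
  -- Given these, the tail is `-(wₙ + cₙ fp) / (dₙ + λ)` and the first two rows give `ϱ` and `r`.
  -- Although `ω` is unbounded, `l` is bounded because `ωₙ / (dₙ + λ)` is square summable.
  let fv := F⁻¹ • (G • (lam • ev 2 + b₁ • ev 0 + b₂ • ev 1) + (b₁ * a) • l)
  let fp := (-(a / G)) • (l + fv)
  let δ : Fin 3 ⊕ ℕ → ℂ := Sum.elim (fun _ => 0) fun n => -(d n + lam)⁻¹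
  let D : ellTwo (Fin 3 ⊕ ℕ) →L[ℂ] ellTwo (Fin 3 ⊕ ℕ) :=
    lp.mapCLM 2 (fun i => δ i • ContinuousLinearMap.id ℂ ℂ) hK0 (by
      rintro (i | n)
      · rw [norm_smul, ContinuousLinearMap.norm_id, mul_one]
        simpa [δ] using hK0
      · rw [norm_smul, ContinuousLinearMap.norm_id, mul_one]
        simpa [δ] using hK n)
  have hD : ∀ w i, D w i = δ i * w i := by intro w i; simp [D]
  let S : ellTwo (Fin 3 ⊕ ℕ) →L[ℂ] ellTwo (Fin 3 ⊕ ℕ) :=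
    D - fp.smulRight e + (lam⁻¹ • (fp - ev 0)).smulRight (lp.single 2 (.inl 0) 1) +
      (lam⁻¹ • (fv - ev 1)).smulRight (lp.single 2 (.inl 1) 1) +
      fv.smulRight (lp.single 2 (.inl 2) 1)
  have el : ∀ i, e (.inl i) = 0 := fun _ => rfl
  have er : ∀ n, e (.inr n) = c n / (d n + lam) := fun _ => rfl
  have hS : ∀ w i, S w i = δ i * w i - fp w * e i +
      (lam⁻¹ * (fp w - w (.inl 0))) * (lp.single 2 (.inl 0) 1 : ellTwo (Fin 3 ⊕ ℕ)) i +
      (lam⁻¹ * (fv w - w (.inl 1))) * (lp.single 2 (.inl 1) 1 : ellTwo (Fin 3 ⊕ ℕ)) i +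
      fv w * (lp.single 2 (.inl 2) 1 : ellTwo (Fin 3 ⊕ ℕ)) i := by
    intro w i; rw [← hD]; rfl
  have S0 : ∀ w, S w (.inl 0) = lam⁻¹ * (fp w - w (.inl 0)) := by
    intro w; simp [hS, δ, el]
  have S1 : ∀ w, S w (.inl 1) = lam⁻¹ * (fv w - w (.inl 1)) := by
    intro w; simp [hS, δ, el]
  have S2 : ∀ w, S w (.inl 2) = fv w := by
    intro w; simp [hS, δ, el]
  have Sn : ∀ w n, S w (.inr n) = -(d n + lam)⁻¹ * w (.inr n) - fp w * (c n / (d n + lam)) := by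
    intro w n; simp [hS, δ, er]
  have hfv : ∀ w, F * fv w =
      G * (lam * w (.inl 2) + b₁ * w (.inl 0) + b₂ * w (.inl 1)) + b₁ * a * l w := by
    intro w
    have : fv w = F⁻¹ *
        (G * (lam * w (.inl 2) + b₁ * w (.inl 0) + b₂ * w (.inl 1)) + b₁ * a * l w) := rfl
    rw [this, mul_inv_cancel_left₀ hF]
  have hfp : ∀ w, G * fp w = -a * (l w + fv w) := by
    intro w
    have : fp w = -(a / G) * (l w + fv w) := rfl
    rw [this]; field_simp
  have hs : ∀ w, HasSum (fun n => ω n * S w (.inr n)) (-l w - fp w * g) := by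
    intro w
    refine ((hl w).neg.sub (hg.mul_left (fp w))).congr_fun fun n => ?_
    rw [Sn]; ring
  have hp : ∀ w, a * (-l w - fp w * g - fv w) = fp w := by
    intro w
    linear_combination -hfp w + fp w * hGdef
  have hact : ∀ w, bubbleAction a b₁ b₂ b₃ c d (-l w - fp w * g) (S w) = w + lam • S w := by
    intro w
    funext i
    rcases i with i | n
    · fin_cases i
      · simp [bubbleAction, S0, S2, hp, hlam]
      · simp [bubbleAction, S1, S2, hlam]
      · have h1 : b₁ * (fp w - w (.inl 0)) + b₂ * (fv w - w (.inl 1)) - b₃ * lam * fv w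
            = lam * w (.inl 2) + lam ^ 2 * fv w := by
          refine mul_left_cancel₀ hG ?_
          linear_combination hfv w + b₁ * hfp w - fv w * hFdef
        simp [bubbleAction, S0, S1, S2]
        field_simp
        linear_combination h1
    · have h1 := hne n
      simp [bubbleAction, S2, Sn, hp]
      field_simp
      ring
  have hmem : ∀ w, S w ∈ matrixDomain (bubbleMatrix a b₁ b₂ b₃ c ω d) := fun w =>
    mem_matrixDomain_of_hasSum (hs w) (by rw [hact]; exact (w + lam • S w).2)
  have hright : ∀ w, matrixOperator (bubbleMatrix a b₁ b₂ b₃ c ω d) ⟨S w, hmem w⟩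
      = w + lam • S w := by
    intro w
    ext i
    rw [matrixOperator_bubbleMatrix_apply ⟨S w, hmem w⟩ (hs w) i]
    exact congrFun (hact w) i
  -- Injectivity of `𝓛 - λ` turns the right inverse into a two-sided one. Elimination gives `F v =
  -- 0`, and then `G ≠ 0` kills `ϱ` and with it the tail.
  have hinj : ∀ z : (matrixOperator (bubbleMatrix a b₁ b₂ b₃ c ω d)).domain,
      matrixOperator (bubbleMatrix a b₁ b₂ b₃ c ω d) z = lam • (z : ellTwo (Fin 3 ⊕ ℕ)) →
      z = 0 := by
    intro z hz
    obtain ⟨s, hsz⟩ := summable_of_mem_matrixDomain ha z.2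
    have hz' : ∀ i, bubbleAction a b₁ b₂ b₃ c d s (z : ellTwo (Fin 3 ⊕ ℕ)) i =
        lam * (z : ellTwo (Fin 3 ⊕ ℕ)) i := by
      intro i
      rw [← matrixOperator_bubbleMatrix_apply z hsz i, hz]
      rfl
    set y : Fin 3 ⊕ ℕ → ℂ := ((z : ellTwo (Fin 3 ⊕ ℕ)) : ∀ _, ℂ) with hy
    have e0 : a * (s - y (.inl 2)) = lam * y (.inl 0) := hz' (.inl 0)
    have e1 : y (.inl 2) = lam * y (.inl 1) := hz' (.inl 1)
    have e2 : b₁ * y (.inl 0) + b₂ * y (.inl 1) - b₃ * y (.inl 2) = lam * y (.inl 2) :=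
      hz' (.inl 2)
    have en : ∀ n, y (.inr n) = -(lam * y (.inl 0)) * (c n / (d n + lam)) := by
      intro n
      have h1 : -(d n * y (.inr n)) - c n * (a * (s - y (.inl 2))) = lam * y (.inr n) :=
        hz' (.inr n)
      have h2 := hne n
      field_simp
      rw [e0] at h1
      linear_combination -h1
    have hs2 : s = -(lam * y (.inl 0)) * g := by
      refine hsz.unique ((hg.mul_left (-(lam * y (.inl 0)))).congr_fun fun n => ?_)
      rw [en]; ring
    have h3 : G * (lam * y (.inl 0)) = -a * y (.inl 2) := by
      linear_combination (lam * y (.inl 0)) * hGdef - e0 + a * hs2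
    have h4 : F * y (.inl 2) = 0 := by
      linear_combination y (.inl 2) * hFdef + G * lam * e2 + b₂ * G * e1 - b₁ * h3
    have y2 : y (.inl 2) = 0 := (mul_eq_zero.mp h4).resolve_left hF
    have y1 : y (.inl 1) = 0 := by
      rw [y2] at e1
      exact (mul_eq_zero.mp e1.symm).resolve_left hlam
    have y0 : y (.inl 0) = 0 := by
      rw [y2, mul_zero] at h3
      exact (mul_eq_zero.mp ((mul_eq_zero.mp h3).resolve_left hG)).resolve_left hlam
    ext i
    rcases i with i | n
    · fin_cases i
      · exact y0
      · exact y1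
      · exact y2
    · change y (.inr n) = 0
      rw [en, y0]; simp
  refine ⟨S, fun w => ⟨hmem w, ?_⟩, fun z => ?_⟩
  · rw [hright]; simp
  · have h1 := hinj (⟨_, hmem _⟩ - z) (by
      rw [LinearPMap.map_sub, hright (matrixOperator _ z - lam • (z : ellTwo (Fin 3 ⊕ ℕ)))]
      simp only [AddSubgroupClass.coe_sub, smul_sub]
      abel)
    have h2 := congrArg Subtype.val h1
    exact sub_eq_zero.mp h2

end BubbleSpectrum

namespace BubbleSpectrum

open Set Real

/-! ### Sums over the radial Dirichlet eigenvalues -/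

/-- `∑ₖ 1 / (π² k² + x)` for complex `x`. -/
def dirichletSum (x : ℂ) : ℂ := ∑' n, ((eigval n : ℂ) + x)⁻¹

/-- `∑ₖ 1 / (π² k² + u)` for real `u`. -/
def dirichletSumReal (u : ℝ) : ℝ := ∑' n, (eigval n + u)⁻¹

lemma eigval_zero : eigval 0 = π ^ 2 := by simp [eigval]

lemma eigval_mono : Monotone eigval := by
  intro k n h
  unfold eigval
  gcongr

lemma pi_sq_le_eigval (n : ℕ) : π ^ 2 ≤ eigval n := eigval_zero ▸ eigval_mono (Nat.zero_le n)

lemma eigval_add_pos {u : ℝ} (hu : -π ^ 2 < u) (n : ℕ) : 0 < eigval n + u := by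
  have := pi_sq_le_eigval n
  linarith

/-- For `u < 0` the shift is absorbed by `u ≥ u (n + 1)²`. The resulting quadratic growth is behind
all convergence statements and the decay of the resolvent. -/
lemma le_eigval_add {u : ℝ} (n : ℕ) :
    min (π ^ 2) (π ^ 2 + u) * ((n : ℝ) + 1) ^ 2 ≤ eigval n + u := by
  have h1 : (1 : ℝ) ≤ ((n : ℝ) + 1) ^ 2 := by
    have : (0 : ℝ) ≤ n := n.cast_nonneg
    nlinarith
  have h2 : eigval n = π ^ 2 * ((n : ℝ) + 1) ^ 2 := by unfold eigval; ring
  rw [h2]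
  rcases le_total 0 u with h | h
  · rw [min_eq_left (by linarith)]; linarith
  · rw [min_eq_right (by linarith)]; nlinarith

lemma summable_inv_succ_sq : Summable fun n : ℕ => (((n : ℝ) + 1) ^ 2)⁻¹ := by
  have := (summable_nat_add_iff 1).2 (Real.summable_nat_pow_inv.2 (one_lt_two))
  simpa using this

lemma summable_inv_eigval_add {u : ℝ} (hu : -π ^ 2 < u) :
    Summable fun n => (eigval n + u)⁻¹ := by
  have hc : 0 < min (π ^ 2) (π ^ 2 + u) := lt_min (by positivity) (by linarith)
  refine Summable.of_nonneg_of_le (fun n => (inv_pos.2 (eigval_add_pos hu n)).le) (fun n => ?_)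
    (summable_inv_succ_sq.mul_left (min (π ^ 2) (π ^ 2 + u))⁻¹)
  rw [← mul_inv]
  exact inv_anti₀ (by positivity) (le_eigval_add n)

lemma eigval_add_re_le_norm (x : ℂ) (n : ℕ) : eigval n + x.re ≤ ‖(eigval n : ℂ) + x‖ := by
  have := Complex.re_le_norm ((eigval n : ℂ) + x)
  simpa using this

lemma eigval_add_ne_zero {x : ℂ} (hx : -π ^ 2 < x.re) (n : ℕ) : (eigval n : ℂ) + x ≠ 0 :=
  norm_pos_iff.1 ((eigval_add_pos hx n).trans_le (eigval_add_re_le_norm x n))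

lemma norm_inv_eigval_add_le {x : ℂ} (hx : -π ^ 2 < x.re) (n : ℕ) :
    ‖((eigval n : ℂ) + x)⁻¹‖ ≤ (eigval n + x.re)⁻¹ := by
  rw [norm_inv]
  exact inv_anti₀ (eigval_add_pos hx n) (eigval_add_re_le_norm x n)

lemma summable_dirichletSum {x : ℂ} (hx : -π ^ 2 < x.re) :
    Summable fun n => ((eigval n : ℂ) + x)⁻¹ :=
  (summable_inv_eigval_add hx).of_norm_bounded (norm_inv_eigval_add_le hx)

lemma norm_dirichletSum_le {x : ℂ} (hx : -π ^ 2 < x.re) :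
    ‖dirichletSum x‖ ≤ dirichletSumReal x.re :=
  tsum_of_norm_bounded (summable_inv_eigval_add hx).hasSum (norm_inv_eigval_add_le hx)

lemma re_dirichletSum_nonneg {x : ℂ} (hx : -π ^ 2 < x.re) : 0 ≤ (dirichletSum x).re := by
  rw [dirichletSum, Complex.re_tsum (summable_dirichletSum hx)]
  refine tsum_nonneg fun n => ?_
  rw [Complex.inv_re]
  have := eigval_add_pos hx n
  exact div_nonneg (by simpa using this.le) (Complex.normSq_nonneg _)

/-- Since `Im (1 / w) = -Im w / |w|²`, all terms of the imaginary part carry the same sign; dividing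
by `Im x` leaves a positive series. -/
lemma hasSum_inv_normSq {x : ℂ} (hx : -π ^ 2 < x.re) (hy : x.im ≠ 0) :
    HasSum (fun n => (Complex.normSq ((eigval n : ℂ) + x))⁻¹) (-(dirichletSum x).im / x.im) := by
  have h := (Complex.hasSum_im (summable_dirichletSum hx).hasSum).mul_left (-x.im⁻¹)
  have h2 : -(dirichletSum x).im / x.im = -x.im⁻¹ * (∑' n, ((eigval n : ℂ) + x)⁻¹).im := by
    unfold dirichletSum; ring
  rw [h2]
  refine h.congr_fun fun n => ?_
  rw [Complex.inv_im]
  simp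
  field_simp

/-- Comparison of the sum of the `|π² k² + x|⁻²` with its first `N` terms. -/
lemma le_of_hasSum_inv_normSq {x : ℂ} (hx : -π ^ 2 < x.re) {P : ℝ}
    (hP : HasSum (fun n => (Complex.normSq ((eigval n : ℂ) + x))⁻¹) P) (N : ℕ) :
    N / (2 * eigval N ^ 2 + 2 * ‖x‖ ^ 2) ≤ P := by
  have h1 := sum_le_hasSum (Finset.range N)
    (fun n _ => inv_nonneg.2 (Complex.normSq_nonneg _)) hP
  refine le_trans ?_ h1
  have h3 : ∀ n ∈ Finset.range N, (2 * eigval N ^ 2 + 2 * ‖x‖ ^ 2)⁻¹ ≤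
      (Complex.normSq ((eigval n : ℂ) + x))⁻¹ := by
    intro n hn
    refine inv_anti₀ (Complex.normSq_pos.2 (eigval_add_ne_zero hx n)) ?_
    have h2 : ‖(eigval n : ℂ) + x‖ ≤ eigval N + ‖x‖ := by
      refine (norm_add_le _ _).trans ?_
      rw [Complex.norm_real, Real.norm_of_nonneg
        ((by positivity : (0:ℝ) ≤ π ^ 2).trans (pi_sq_le_eigval n))]
      have := eigval_mono (Finset.mem_range.1 hn).le
      gcongr
    rw [Complex.normSq_eq_norm_sq]
    calc ‖(eigval n : ℂ) + x‖ ^ 2 ≤ (eigval N + ‖x‖) ^ 2 := by gcongr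
      _ ≤ 2 * eigval N ^ 2 + 2 * ‖x‖ ^ 2 := by nlinarith [sq_nonneg (eigval N - ‖x‖)]
  have h4 := Finset.card_nsmul_le_sum _ _ _ h3
  rwa [Finset.card_range, nsmul_eq_mul, ← div_eq_mul_inv] at h4

lemma dirichletSum_ofReal (u : ℝ) : dirichletSum u = dirichletSumReal u := by
  simp [dirichletSum, dirichletSumReal, Complex.ofReal_tsum]

lemma dirichletSumReal_nonneg {u : ℝ} (hu : -π ^ 2 < u) : 0 ≤ dirichletSumReal u :=
  tsum_nonneg fun n => (inv_pos.2 (eigval_add_pos hu n)).le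

lemma dirichletSumReal_zero : dirichletSumReal 0 = 1 / 6 := by
  -- Removing the term of index `0` from the Basel series costs nothing, since `1 / 0 = 0`.
  have h := (hasSum_nat_add_iff' 1).2 hasSum_zeta_two
  have h2 := h.mul_left (π ^ 2)⁻¹
  rw [dirichletSumReal]
  have h3 : (fun n => (eigval n + 0)⁻¹) =
      fun n : ℕ => (π ^ 2)⁻¹ * (1 / ((n + 1 : ℕ) : ℝ) ^ 2) := by
    funext n
    simp [eigval, mul_pow, mul_comm]
  rw [h3, h2.tsum_eq]
  simp
  field_simp

lemma strictAntiOn_dirichletSumReal : StrictAntiOn dirichletSumReal (Ioi (-π ^ 2)) := by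
  intro u hu w hw huw
  refine Summable.tsum_lt_tsum (i := 0) (fun n => ?_) ?_ (summable_inv_eigval_add hw)
    (summable_inv_eigval_add hu)
  · exact inv_anti₀ (eigval_add_pos hu n) (by linarith)
  · exact inv_strictAnti₀ (eigval_add_pos hu 0) (by linarith)

lemma continuousOn_dirichletSumReal {b : ℝ} (hb : -π ^ 2 < b) :
    ContinuousOn dirichletSumReal (Ici b) := by
  refine continuousOn_tsum (fun n => ?_) (summable_inv_eigval_add hb) fun n u hu => ?_
  · refine ContinuousOn.inv₀ (by fun_prop) fun u hu => ?_
    exact (eigval_add_pos (hb.trans_le hu) n).ne'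
  · rw [Real.norm_of_nonneg (inv_pos.2 (eigval_add_pos (hb.trans_le hu) n)).le]
    exact inv_anti₀ (eigval_add_pos hb n) (by have : b ≤ u := hu; linarith)

/-! ### Roots of the characteristic equation -/

/-- The thermal factor `1 + 6 (γ - 1) ∑ₖ 1 / (π² k² + u)` on the real line. -/
def thermalReal (γ u : ℝ) : ℝ := 1 + 6 * (γ - 1) * dirichletSumReal u

/-- The thermal factor `1 + 6 (γ - 1) ∑ₖ 1 / (π² k² + x)` in the complex plane. -/
def thermal (γ : ℝ) (x : ℂ) : ℂ := 1 + 6 * ((γ : ℂ) - 1) * dirichletSum x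

variable {γ : ℝ}

lemma thermal_ofReal (u : ℝ) : thermal γ u = thermalReal γ u := by
  simp [thermal, thermalReal, dirichletSum_ofReal]

lemma thermalReal_zero : thermalReal γ 0 = γ := by
  rw [thermalReal, dirichletSumReal_zero]; ring

lemma one_le_thermalReal (hγ : 1 < γ) {u : ℝ} (hu : -π ^ 2 < u) : 1 ≤ thermalReal γ u := by
  have := mul_nonneg (sub_pos.2 hγ).le (dirichletSumReal_nonneg hu)
  unfold thermalReal
  linarith

lemma strictAntiOn_thermalReal (hγ : 1 < γ) : StrictAntiOn (thermalReal γ) (Ioi (-π ^ 2)) := by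
  intro u hu w hw huw
  have := mul_lt_mul_of_pos_left (strictAntiOn_dirichletSumReal hu hw huw) (sub_pos.2 hγ)
  unfold thermalReal
  linarith

lemma continuousOn_thermalReal {b : ℝ} (hb : -π ^ 2 < b) :
    ContinuousOn (thermalReal γ) (Ici b) :=
  continuousOn_const.add (continuousOn_const.mul (continuousOn_dirichletSumReal hb))

/-- Each `1 / (π² k² + x)` has positive real part. This excludes zeros of `G`, and it gives `|G| ≥
1` in the size estimate for non-real roots. -/
lemma one_le_re_thermal (hγ : 1 < γ) {x : ℂ} (hx : -π ^ 2 < x.re) : 1 ≤ (thermal γ x).re := by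
  have := mul_nonneg (sub_pos.2 hγ).le (re_dirichletSum_nonneg hx)
  have h : (thermal γ x).re = 1 + 6 * ((γ - 1) * (dirichletSum x).re) := by
    simp [thermal, mul_assoc]
  linarith

lemma thermal_ne_zero (hγ : 1 < γ) {x : ℂ} (hx : -π ^ 2 < x.re) : thermal γ x ≠ 0 := by
  intro h
  have := one_le_re_thermal hγ hx
  rw [h] at this
  norm_num at this

lemma norm_thermal_le (hγ : 1 < γ) {x : ℂ} (hx : -π ^ 2 < x.re) :
    ‖thermal γ x‖ ≤ thermalReal γ x.re := by
  have h6 : ‖(6 * ((γ : ℂ) - 1))‖ = 6 * (γ - 1) := by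
    rw [← Complex.ofReal_one, ← Complex.ofReal_sub, norm_mul, Complex.norm_real,
      Real.norm_of_nonneg (sub_pos.2 hγ).le]
    norm_num
  refine (norm_add_le _ _).trans ?_
  rw [norm_mul, h6, norm_one]
  have := mul_le_mul_of_nonneg_left (norm_dirichletSum_le hx) (sub_pos.2 hγ).le
  unfold thermalReal
  linarith

/-- The limiting characteristic equation has a real solution between `-π²` and `0`. -/
theorem exists_thermalReal_eq (hγ : 1 < γ) :
    ∃ u : ℝ, -π ^ 2 < u ∧ u < 0 ∧ thermalReal γ u = 3 * γ := by
  have hπ : 9 < π ^ 2 := by nlinarith [Real.pi_gt_three]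
  set t : ℝ := 2 * (γ - 1) / γ with ht
  have ht0 : 0 < t := by
    have := sub_pos.2 hγ
    positivity
  have ht2 : t < 2 := by
    rw [ht, div_lt_iff₀ (by linarith)]; linarith
  have hb : -π ^ 2 < -π ^ 2 + t := by linarith
  have h1 : 3 * γ ≤ thermalReal γ (-π ^ 2 + t) := by
    -- The first term of the sum alone is `1 / t`, and `t` was chosen so that `6 (γ - 1) / t = 3 γ`.
    have h2 : t⁻¹ ≤ dirichletSumReal (-π ^ 2 + t) := by
      have := (summable_inv_eigval_add hb).le_tsum 0
        fun n _ => (inv_pos.2 (eigval_add_pos hb n)).le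
      rw [eigval_zero] at this
      simpa [dirichletSumReal] using this
    have h3 : 6 * (γ - 1) * t⁻¹ = 3 * γ := by
      have := sub_pos.2 hγ
      rw [ht]
      field_simp
      norm_num
    have h4 := mul_le_mul_of_nonneg_left h2 (sub_pos.2 hγ).le
    unfold thermalReal
    linarith
  obtain ⟨u, hu, hu3⟩ := intermediate_value_Icc' (a := -π ^ 2 + t) (b := 0) (by linarith)
    ((continuousOn_thermalReal (γ := γ) hb).mono Icc_subset_Ici_self)
    (show 3 * γ ∈ Icc _ _ from ⟨by rw [thermalReal_zero]; linarith, h1⟩)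
  refine ⟨u, by linarith [hu.1], lt_of_le_of_ne hu.2 ?_, hu3⟩
  rintro rfl
  rw [thermalReal_zero] at hu3
  linarith

/-- Non-real roots of the perturbed characteristic equation stay left of `-β`. -/
theorem exists_forall_nonreal_ne (hγ : 1 < γ) {β : ℝ} (hβ0 : 0 ≤ β) (hβ : β < π ^ 2) :
    ∃ ε₀ : ℝ, 0 < ε₀ ∧ ∀ ε δ A : ℝ, 0 < ε → ε < ε₀ → 0 ≤ δ → 3 * γ ≤ A → A ≤ 3 * γ + 1 →
      ∀ x : ℂ, -β ≤ x.re → x.im ≠ 0 →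
        thermal γ x * (1 - δ * x - ε * x ^ 2) ≠ A := by
  have hγ1 := sub_pos.2 hγ
  set g := thermalReal γ (-β) with hg
  set K₁ : ℝ := g ^ 2 * (2 * β) / (18 * γ * (γ - 1)) with hK₁
  set K₂ : ℝ := 2 * (3 * γ + 2) + 4 * β ^ 2 with hK₂
  have hK₁0 : 0 ≤ K₁ := by positivity
  -- `N` depends only on `γ` and `β`, so the bound on `ε` may depend on the eigenvalue `E` of index
  -- `N`.
  obtain ⟨N, hN⟩ := exists_nat_gt (K₁ * (1 + 2 * K₂))
  set E : ℝ := eigval N with hE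
  have hEpos : 0 < E := lt_of_lt_of_le (by positivity) (pi_sq_le_eigval N)
  refine ⟨min 1 (1 / (2 * E ^ 2)), by positivity, ?_⟩
  intro ε δ A hε hε₀ hδ hA hA' x hx hy heq
  have hε1 : ε < 1 := hε₀.trans_le (min_le_left _ _)
  have hε2 : 2 * E ^ 2 * ε < 1 := by
    have := hε₀.trans_le (min_le_right _ _)
    rw [lt_div_iff₀ (by positivity)] at this
    linarith
  have hx' : -π ^ 2 < x.re := by linarith
  set G := thermal γ x with hGdef
  have hre := one_le_re_thermal hγ hx'
  have hnorm1 : 1 ≤ ‖G‖ := hre.trans (Complex.re_le_norm _)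
  have hnorm2 : ‖G‖ ≤ g := (norm_thermal_le hγ hx').trans
    ((strictAntiOn_thermalReal hγ).antitoneOn (show -π ^ 2 < -β by linarith) hx' hx)
  set P := -(dirichletSum x).im / x.im with hP
  have hPsum := hasSum_inv_normSq hx' hy
  -- the imaginary part of the equation
  have hGim : G.im = -(6 * (γ - 1) * P * x.im) := by
    have : G.im = 6 * ((γ - 1) * (dirichletSum x).im) := by simp [hGdef, thermal, mul_assoc]
    rw [this, hP]
    field_simp
  have hGsq : ‖G‖ ^ 2 = G.re ^ 2 + G.im ^ 2 := by
    rw [← Complex.normSq_eq_norm_sq, Complex.normSq_apply]; ring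
  -- Imaginary part of `1 - δ x - ε x² = A / G`, divided by `Im x` and multiplied by `-‖G‖²`. As `P
  -- > 0`, it forces `δ < -2 ε Re x` and `P = O(ε)`.
  have him : ‖G‖ ^ 2 * (δ + 2 * ε * x.re) = -(6 * (γ - 1) * A * P) := by
    have e1 := congrArg Complex.re heq
    have e2 := congrArg Complex.im heq
    simp [pow_two] at e1 e2
    refine mul_right_cancel₀ hy ?_
    rw [hGsq]
    linear_combination G.im * e1 - G.re * e2 + A * hGim
  have hPpos : 0 < P := by
    refine lt_of_lt_of_le ?_ (hPsum.summable.hasSum.unique hPsum ▸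
      hPsum.summable.le_tsum 0 fun n _ => inv_nonneg.2 (Complex.normSq_nonneg _))
    exact inv_pos.2 (Complex.normSq_pos.2 (eigval_add_ne_zero hx' 0))
  have hApos : 0 < A := by linarith
  have hneg : δ + 2 * ε * x.re < 0 := by
    by_contra h
    have h1 : 0 ≤ ‖G‖ ^ 2 * (δ + 2 * ε * x.re) := mul_nonneg (by positivity) (not_lt.1 h)
    have h2 : 0 < 6 * (γ - 1) * A * P := by positivity
    linarith
  have hεx : ε * -β ≤ ε * x.re := mul_le_mul_of_nonneg_left hx hε.le
  have hδ2 : δ ≤ 2 * ε * β := by linarith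
  have hP1 : P ≤ K₁ * ε := by
    have h1 : 6 * (γ - 1) * (3 * γ) * P ≤ 6 * (γ - 1) * A * P := by gcongr
    have h2 : ‖G‖ ^ 2 * -(δ + 2 * ε * x.re) ≤ g ^ 2 * (2 * ε * β) := by
      refine mul_le_mul (by gcongr) (by linarith) (by linarith) (by positivity)
    rw [hK₁, div_mul_eq_mul_div, le_div_iff₀ (by positivity)]
    linarith
  -- the size of the root
  have hQ : ‖1 - δ * x - ε * x ^ 2‖ ≤ A := by
    have h1 : ‖G‖ * ‖1 - δ * x - ε * x ^ 2‖ = A := by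
      rw [← norm_mul, heq, Complex.norm_real, Real.norm_of_nonneg hApos.le]
    have h2 := norm_nonneg (1 - δ * x - ε * x ^ 2)
    nlinarith
  -- From `ε x² = 1 - δ x - A / G` with `|A / G| ≤ A`. The linear term has coefficient at most `2 ε
  -- β`, so half of `ε |x|²` absorbs it.
  have hsize : ε * ‖x‖ ^ 2 ≤ K₂ := by
    have h1 : (ε : ℂ) * x ^ 2 = 1 - δ * x - (1 - δ * x - ε * x ^ 2) := by ring
    have h2 : ε * ‖x‖ ^ 2 ≤ 1 + δ * ‖x‖ + A := by
      calc ε * ‖x‖ ^ 2 = ‖(ε : ℂ) * x ^ 2‖ := by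
            rw [norm_mul, norm_pow, Complex.norm_real, Real.norm_of_nonneg hε.le]
        _ ≤ ‖(1 : ℂ)‖ + ‖(δ : ℂ) * x‖ + ‖1 - δ * x - ε * x ^ 2‖ := by
            conv_lhs => rw [h1]
            exact (norm_sub_le _ _).trans (add_le_add_left (norm_sub_le _ _) _)
        _ ≤ 1 + δ * ‖x‖ + A := by
            rw [norm_one, norm_mul, Complex.norm_real, Real.norm_of_nonneg hδ]
            gcongr
    have h3 : δ * ‖x‖ ≤ 2 * ε * β * ‖x‖ := by gcongr
    have h4 : 2 * ε * β * ‖x‖ ≤ ε * ‖x‖ ^ 2 / 2 + 2 * ε * β ^ 2 := by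
      have : 0 ≤ ε * (‖x‖ - 2 * β) ^ 2 := by positivity
      nlinarith
    have h5 : 2 * ε * β ^ 2 ≤ 2 * β ^ 2 := by nlinarith [sq_nonneg β]
    rw [hK₂]
    linarith
  -- many terms of the sum
  have hlow : N / (2 * E ^ 2 + 2 * ‖x‖ ^ 2) ≤ P := le_of_hasSum_inv_normSq hx' hPsum N
  have h1 := hlow.trans hP1
  rw [div_le_iff₀ (by positivity)] at h1
  have h2 : K₁ * ε * (2 * E ^ 2 + 2 * ‖x‖ ^ 2) ≤ K₁ * (1 + 2 * K₂) := by
    rw [mul_assoc]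
    refine mul_le_mul_of_nonneg_left ?_ hK₁0
    linarith
  linarith

/-- The perturbed characteristic equation has no roots with real part at least `-β`, provided
`-β` lies to the right of the root of the limiting equation. -/
theorem exists_forall_characteristic_ne (hγ : 1 < γ) {β : ℝ} (hβ0 : 0 ≤ β) (hβ : β < π ^ 2)
    (hg : thermalReal γ (-β) < 3 * γ) :
    ∃ ε₀ : ℝ, 0 < ε₀ ∧ ∀ ε δ A : ℝ, 0 < ε → ε < ε₀ → 0 ≤ δ → δ < ε₀ → 3 * γ ≤ A →
      A ≤ 3 * γ + 1 → ∀ x : ℂ, -β ≤ x.re → thermal γ x * (1 - δ * x - ε * x ^ 2) ≠ A := by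
  obtain ⟨ε₁, hε₁, h⟩ := exists_forall_nonreal_ne hγ hβ0 hβ
  set g := thermalReal γ (-β) with hgdef
  have hg1 : 1 ≤ g := one_le_thermalReal hγ (by linarith)
  have hg3 := sub_pos.2 hg
  -- The second bound ensures `g (1 + δ β) < 3 γ ≤ A`, which rules out real roots; the `+ 1` covers
  -- `β = 0`.
  refine ⟨min ε₁ ((3 * γ - g) / (g * β + 1)), lt_min hε₁ (by positivity), ?_⟩
  intro ε δ A hε hεε hδ hδε hA hA' x hx
  by_cases hy : x.im = 0
  · obtain ⟨u, rfl⟩ : ∃ u : ℝ, x = u := ⟨x.re, Complex.ext rfl (by simpa using hy)⟩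
    rw [Complex.ofReal_re] at hx
    intro heq
    rw [thermal_ofReal] at heq
    have heq' : thermalReal γ u * (1 - δ * u - ε * u ^ 2) = A := by exact_mod_cast heq
    have hu : -π ^ 2 < u := by linarith
    have h1 := one_le_thermalReal hγ hu
    have h2 : thermalReal γ u ≤ g :=
      (strictAntiOn_thermalReal hγ).antitoneOn (show -π ^ 2 < -β by linarith) hu hx
    have h3 : 1 - δ * u - ε * u ^ 2 ≤ 1 + δ * β := by
      have : δ * -β ≤ δ * u := mul_le_mul_of_nonneg_left hx hδ
      have : 0 ≤ ε * u ^ 2 := by positivity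
      linarith
    have h4 : thermalReal γ u * (1 - δ * u - ε * u ^ 2) ≤ g * (1 + δ * β) :=
      (mul_le_mul_of_nonneg_left h3 (by linarith)).trans
        (mul_le_mul_of_nonneg_right h2 (by positivity))
    have h5 := hδε.trans_le (min_le_right _ _)
    rw [lt_div_iff₀ (by positivity)] at h5
    nlinarith
  · exact h ε δ A hε (hεε.trans_le (min_le_left _ _)) hδ hA hA' x hx hy

/-- The perturbed characteristic equation has a real root to the right of any point that lies to
the left of the root of the limiting equation. -/
theorem exists_forall_characteristic_root (hγ : 1 < γ) {b : ℝ} (hb : -π ^ 2 < b) (hb0 : b < 0)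
    (hg : 3 * γ < thermalReal γ b) :
    ∃ ε₀ : ℝ, 0 < ε₀ ∧ ∀ ε δ A : ℝ, 0 < ε → ε < ε₀ → 0 ≤ δ → 3 * γ ≤ A → A < 3 * γ + ε₀ →
      ∃ u : ℝ, b < u ∧ u < 0 ∧ thermalReal γ u * (1 - δ * u - ε * u ^ 2) = A := by
  set g := thermalReal γ b with hgdef
  have hg1 : 1 ≤ g := one_le_thermalReal hγ hb
  have hg3 := sub_pos.2 hg
  -- This constant `ε₀` solves `g - g b² ε₀ = 3 γ + ε₀`, so the left side of the equation still
  -- exceeds `A` at `b`; at `0` it equals `γ < A`.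
  refine ⟨(g - 3 * γ) / (1 + g * b ^ 2), by positivity, ?_⟩
  intro ε δ A hε hε₀ hδ hA hA'
  set ε₀ := (g - 3 * γ) / (1 + g * b ^ 2) with hε₀def
  have he : ε₀ * (1 + g * b ^ 2) = g - 3 * γ := by rw [hε₀def]; field_simp
  have h1 : A < g * (1 - δ * b - ε * b ^ 2) := by
    have h2 : 0 ≤ g * (δ * -b) := by
      have : 0 < -b := by linarith
      positivity
    have h3 : g * b ^ 2 * ε ≤ g * b ^ 2 * ε₀ := by gcongr
    linarith
  have h0 : thermalReal γ 0 * (1 - δ * 0 - ε * 0 ^ 2) < A := by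
    rw [thermalReal_zero]; linarith
  have hcont : ContinuousOn (fun u => thermalReal γ u * (1 - δ * u - ε * u ^ 2)) (Icc b 0) :=
    ((continuousOn_thermalReal hb).mono Icc_subset_Ici_self).mul (by fun_prop)
  obtain ⟨u, hu, hu2⟩ := intermediate_value_Ioo' hb0.le hcont ⟨h0, h1⟩
  exact ⟨u, hu.1, hu.2, hu2⟩

end BubbleSpectrum

namespace BubbleSpectrum

open Filter Topology Set

/-! ### The equilibrium for small liquid volumes -/

lemma volBar_pos {V : ℝ} (hV : 0 < V) : 0 < volBar V := by unfold volBar; positivity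

lemma outerRadius_cube {V R : ℝ} (hV : 0 < V) (hR : 0 < R) :
    outerRadius V R ^ 3 = R ^ 3 + volBar V := by
  have := volBar_pos hV
  unfold outerRadius
  rw [← Real.rpow_natCast, ← Real.rpow_mul (by positivity)]
  norm_num

lemma Medium.one_lt_gamma (m : Medium) : 1 < m.gamma := by
  have := m.rGas_pos
  have := m.cHeat_pos
  have : 0 < m.rGas / m.cHeat := by positivity
  unfold Medium.gamma
  linarith

/-- The ratio `R† / R̄†` of the equilibrium radii. -/
def Medium.ratio (m : Medium) (T M V : ℝ) : ℝ := m.rEq T M V / m.rOutEq T M V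

variable (m : Medium) {T M V : ℝ}

lemma Medium.rEq_pos (hT : 0 < T) (hM : 0 < M) (hV : 0 < V) : 0 < m.rEq T M V :=
  (m.isEquilibrium_eq hT hM hV).2.1

lemma Medium.rhoEq_pos (hT : 0 < T) (hM : 0 < M) (hV : 0 < V) : 0 < m.rhoEq T M V :=
  (m.isEquilibrium_eq hT hM hV).1

lemma Medium.rOutEq_pos (hT : 0 < T) (hM : 0 < M) (hV : 0 < V) : 0 < m.rOutEq T M V :=
  outerRadius_pos hV (m.rEq_pos hT hM hV)

lemma Medium.rOutEq_cube (hT : 0 < T) (hM : 0 < M) (hV : 0 < V) :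
    m.rOutEq T M V ^ 3 = m.rEq T M V ^ 3 + volBar V :=
  outerRadius_cube hV (m.rEq_pos hT hM hV)

lemma Medium.ratio_pos (hT : 0 < T) (hM : 0 < M) (hV : 0 < V) : 0 < m.ratio T M V :=
  div_pos (m.rEq_pos hT hM hV) (m.rOutEq_pos hT hM hV)

lemma Medium.ratio_lt_one (hT : 0 < T) (hM : 0 < M) (hV : 0 < V) : m.ratio T M V < 1 := by
  have h := m.rOutEq_cube hT hM hV
  have hb := volBar_pos hV
  rw [Medium.ratio, div_lt_one (m.rOutEq_pos hT hM hV)]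
  exact lt_of_pow_lt_pow_left₀ 3 (m.rOutEq_pos hT hM hV).le (by linarith)

lemma Medium.one_sub_ratio_cube (hT : 0 < T) (hM : 0 < M) (hV : 0 < V) :
    1 - m.ratio T M V ^ 3 = volBar V / (m.rEq T M V ^ 3 + volBar V) := by
  have hR := m.rEq_pos hT hM hV
  have hb := volBar_pos hV
  rw [Medium.ratio, div_pow, m.rOutEq_cube hT hM hV]
  field_simp
  ring

lemma Medium.rhoEq_eq (hT : 0 < T) (hM : 0 < M) (hV : 0 < V) :
    m.rhoEq T M V =
      2 * (m.sigma + m.sigmaBar * m.ratio T M V) / (m.rGas * T * m.rEq T M V) := by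
  have hR := m.rEq_pos hT hM hV
  have hRo := m.rOutEq_pos hT hM hV
  have hg := m.rGas_pos
  have h := (m.isEquilibrium_eq hT hM hV).2.2.2
  change _ = 2 / (m.rGas * T) * (m.sigma / m.rEq T M V + m.sigmaBar / m.rOutEq T M V) at h
  rw [h, Medium.ratio]
  field_simp

lemma Medium.tension_pos (hT : 0 < T) (hM : 0 < M) (hV : 0 < V) :
    0 < m.sigma + m.sigmaBar * m.ratio T M V := by
  have := m.ratio_pos hT hM hV
  have := m.sigma_pos
  have := m.sigmaBar_pos
  positivity

/-- Substituting the pressure balance into the mass constraint leaves only `R²`. All equilibrium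
quantities become explicit in `q`, and the limit `V → 0` reduces to `q → 1`. -/
lemma Medium.rEq_sq (hT : 0 < T) (hM : 0 < M) (hV : 0 < V) :
    m.rEq T M V ^ 2 =
      3 * m.rGas * T * M / (8 * Real.pi * (m.sigma + m.sigmaBar * m.ratio T M V)) := by
  have hR := m.rEq_pos hT hM hV
  have hg := m.rGas_pos
  have ht := m.tension_pos hT hM hV
  have h := (m.isEquilibrium_eq hT hM hV).2.2.1
  rw [m.rhoEq_eq hT hM hV] at h
  have hπ := Real.pi_pos
  rw [eq_div_iff (by positivity)]
  field_simp at h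
  linarith

lemma Medium.rEq_eq (hT : 0 < T) (hM : 0 < M) (hV : 0 < V) :
    m.rEq T M V =
      √(3 * m.rGas * T * M / (8 * Real.pi * (m.sigma + m.sigmaBar * m.ratio T M V))) := by
  rw [← m.rEq_sq hT hM hV, Real.sqrt_sq (m.rEq_pos hT hM hV).le]

lemma Medium.kappaBar_pos (hT : 0 < T) (hM : 0 < M) (hV : 0 < V) : 0 < m.kappaBar T M V := by
  have := m.rEq_pos hT hM hV
  have := m.rhoEq_pos hT hM hV
  have := m.cHeat_pos
  have := m.kTh_pos
  have := m.one_lt_gamma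
  unfold Medium.kappaBar
  positivity

/-- The value of `κ̄` as a function of the ratio `q` of the radii. -/
def Medium.kappaOfRatio (m : Medium) (T M q : ℝ) : ℝ :=
  m.kTh / (m.gamma * m.cHeat) * √(2 * Real.pi * m.rGas / (3 * m.sigma)) *
    (√(T / M) / √(1 + m.sigmaBar / m.sigma * q))

/-- `R² ρ` is proportional to `R (σ + σ̄ q)` and `R` to `(σ + σ̄ q)^(-1/2)`, so `κ̄` varies like `(σ
+ σ̄ q)^(-1/2)`. -/
lemma Medium.kappaBar_eq (hT : 0 < T) (hM : 0 < M) (hV : 0 < V) :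
    m.kappaBar T M V = m.kappaOfRatio T M (m.ratio T M V) := by
  have hR := m.rEq_pos hT hM hV
  have hk := m.kTh_pos
  have hc := m.cHeat_pos
  have hg := m.rGas_pos
  have hγ : 0 < m.gamma := zero_lt_one.trans m.one_lt_gamma
  have ht := m.tension_pos hT hM hV
  have hσ := m.sigma_pos
  have hσ' := m.sigmaBar_pos
  have hq := m.ratio_pos hT hM hV
  have hπ := Real.pi_pos
  have hsq := m.rEq_sq hT hM hV
  set q := m.ratio T M V with hqdef
  set R := m.rEq T M V with hRdef
  have h1 : √(2 * Real.pi * m.rGas / (3 * m.sigma)) *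
      (√(T / M) / √(1 + m.sigmaBar / m.sigma * q)) =
      m.rGas * T / (2 * R * (m.sigma + m.sigmaBar * q)) := by
    rw [← Real.sqrt_div' _ (by positivity), ← Real.sqrt_mul (by positivity),
      Real.sqrt_eq_iff_mul_self_eq (by positivity) (by positivity)]
    have h2 : m.rGas * T / (2 * R * (m.sigma + m.sigmaBar * q)) *
        (m.rGas * T / (2 * R * (m.sigma + m.sigmaBar * q))) =
        (m.rGas * T) ^ 2 / (4 * R ^ 2 * (m.sigma + m.sigmaBar * q) ^ 2) := by
      field_simp
      norm_num
    rw [h2, hsq]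
    field_simp
    norm_num
  rw [Medium.kappaOfRatio, mul_assoc, h1, Medium.kappaBar, m.rhoEq_eq hT hM hV, ← hRdef, ← hqdef]
  field_simp

lemma Medium.kappaOfRatio_lt (m : Medium) {T M p q : ℝ} (hT : 0 < T) (hM : 0 < M) (hp : 0 ≤ p)
    (hpq : p < q) : m.kappaOfRatio T M q < m.kappaOfRatio T M p := by
  have hk := m.kTh_pos
  have hc := m.cHeat_pos
  have hg := m.rGas_pos
  have hγ : 0 < m.gamma := zero_lt_one.trans m.one_lt_gamma
  have hσ := m.sigma_pos
  have hσ' := m.sigmaBar_pos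
  have hπ := Real.pi_pos
  unfold Medium.kappaOfRatio
  gcongr

/-- A lower bound for the equilibrium radius that does not depend on the liquid volume. -/
lemma Medium.exists_le_rEq (hT : 0 < T) (hM : 0 < M) :
    ∃ r : ℝ, 0 < r ∧ ∀ V, 0 < V → r ≤ m.rEq T M V := by
  have hg := m.rGas_pos
  have hσ := m.sigma_pos
  have hσ' := m.sigmaBar_pos
  have hπ := Real.pi_pos
  refine ⟨√(3 * m.rGas * T * M / (8 * Real.pi * (m.sigma + m.sigmaBar * 1))),
    Real.sqrt_pos.2 (by positivity), fun V hV => ?_⟩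
  rw [m.rEq_eq hT hM hV]
  have := m.ratio_lt_one hT hM hV
  have := m.tension_pos hT hM hV
  gcongr

/-- Squeeze by `0 ≤ 1 - q ≤ 1 - q³ = V̄ / (R³ + V̄) ≤ V̄ / r³`, with `r` a lower bound for `R`
uniform in `V`. -/
lemma Medium.tendsto_ratio (hT : 0 < T) (hM : 0 < M) :
    Tendsto (fun V => m.ratio T M V) (𝓝[>] 0) (𝓝 1) := by
  obtain ⟨r, hr, h⟩ := m.exists_le_rEq hT hM
  have h1 : Tendsto (fun V : ℝ => 1 - volBar V / r ^ 3) (𝓝[>] 0) (𝓝 1) := by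
    have : Continuous fun V : ℝ => 1 - volBar V / r ^ 3 := by unfold volBar; fun_prop
    have h2 := (this.tendsto 0).mono_left (nhdsWithin_le_nhds (s := Ioi 0))
    simpa [volBar] using h2
  refine tendsto_of_tendsto_of_tendsto_of_le_of_le' h1 tendsto_const_nhds ?_ ?_
  · filter_upwards [self_mem_nhdsWithin] with V hV
    have hV : 0 < V := hV
    have hb := volBar_pos hV
    have hq := m.ratio_pos hT hM hV
    have hq1 := m.ratio_lt_one hT hM hV
    have e := m.one_sub_ratio_cube hT hM hV
    have h3 : volBar V / (m.rEq T M V ^ 3 + volBar V) ≤ volBar V / r ^ 3 := by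
      have := h V hV
      have : r ^ 3 ≤ m.rEq T M V ^ 3 := by gcongr
      gcongr
      linarith
    have h4 : m.ratio T M V ^ 3 ≤ m.ratio T M V := by
      have := pow_le_pow_of_le_one hq.le hq1.le (show 1 ≤ 3 by norm_num)
      simpa using this
    linarith
  · filter_upwards [self_mem_nhdsWithin] with V hV
    exact (m.ratio_lt_one hT hM hV).le

lemma Medium.tendsto_kappaBar (hT : 0 < T) (hM : 0 < M) :
    Tendsto (fun V => m.kappaBar T M V) (𝓝[>] 0) (𝓝 (m.kappaOfRatio T M 1)) := by
  have hσ := m.sigma_pos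
  have hσ' := m.sigmaBar_pos
  have hc : ContinuousAt (m.kappaOfRatio T M) 1 := by
    unfold Medium.kappaOfRatio
    refine continuousAt_const.mul (continuousAt_const.div (by fun_prop) ?_)
    positivity
  refine (hc.tendsto.comp (m.tendsto_ratio hT hM)).congr' ?_
  filter_upwards [self_mem_nhdsWithin] with V hV
  exact (m.kappaBar_eq hT hM hV).symm

/-- The value of the limit is immaterial: the radius only appears multiplied by a factor that tends
to zero. -/
lemma Medium.tendsto_rEq (hT : 0 < T) (hM : 0 < M) :
    ∃ r : ℝ, Tendsto (fun V => m.rEq T M V) (𝓝[>] 0) (𝓝 r) := by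
  have hσ := m.sigma_pos
  have hσ' := m.sigmaBar_pos
  have hc : ContinuousAt (fun q : ℝ =>
      √(3 * m.rGas * T * M / (8 * Real.pi * (m.sigma + m.sigmaBar * q)))) 1 := by
    refine (continuousAt_const.div (by fun_prop) ?_).sqrt
    positivity
  refine ⟨_, (hc.tendsto.comp (m.tendsto_ratio hT hM)).congr' ?_⟩
  filter_upwards [self_mem_nhdsWithin] with V hV
  exact (m.rEq_eq hT hM hV).symm

/-! ### The coefficients of the characteristic equation -/

/-- The coupling constant `3 γ ρ† / R†`. -/
def Medium.massCoupling (m : Medium) (T M V : ℝ) : ℝ :=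
  3 * m.gamma * m.rhoEq T M V / m.rEq T M V

/-- The coefficient of the density in the momentum balance. -/
def Medium.pressureCoupling (m : Medium) (T M V : ℝ) : ℝ := m.rGas * T / (m.rhoL * m.rTilde T M V)

/-- The coefficient of the radius in the momentum balance. -/
def Medium.tensionCoupling (m : Medium) (T M V : ℝ) : ℝ :=
  (2 * m.sigma * m.rOutEq T M V ^ 4 + 2 * m.sigmaBar * m.rEq T M V ^ 4) /
    (m.rhoL * m.rTilde T M V * m.rEq T M V ^ 2 * m.rOutEq T M V ^ 4)

/-- The viscous damping in the momentum balance. -/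
def Medium.damping (m : Medium) (T M V : ℝ) : ℝ :=
  4 * m.muL * volBar V /
    (m.rhoL * m.rTilde T M V * m.rEq T M V * (m.rEq T M V ^ 3 + volBar V))

/-- The dimensionless viscous damping. -/
def Medium.charVisc (m : Medium) (T M V : ℝ) : ℝ :=
  m.damping T M V * m.kappaBar T M V / m.tensionCoupling T M V

/-- The dimensionless inertia. -/
def Medium.charInertia (m : Medium) (T M V : ℝ) : ℝ :=
  m.kappaBar T M V ^ 2 / m.tensionCoupling T M V

/-- The dimensionless gas pressure. -/
def Medium.charPressure (m : Medium) (T M V : ℝ) : ℝ :=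
  m.pressureCoupling T M V * m.massCoupling T M V / m.tensionCoupling T M V

lemma Medium.rTilde_eq (m : Medium) (T M V : ℝ) :
    m.rTilde T M V = m.rEq T M V * (1 - m.ratio T M V) := by
  rw [Medium.rTilde, Medium.ratio]; ring

lemma Medium.rTilde_pos (hT : 0 < T) (hM : 0 < M) (hV : 0 < V) : 0 < m.rTilde T M V := by
  rw [m.rTilde_eq]
  exact mul_pos (m.rEq_pos hT hM hV) (sub_pos.2 (m.ratio_lt_one hT hM hV))

lemma Medium.tension_four_pos (hT : 0 < T) (hM : 0 < M) (hV : 0 < V) :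
    0 < m.sigma + m.sigmaBar * m.ratio T M V ^ 4 := by
  have := m.ratio_pos hT hM hV
  have := m.sigma_pos
  have := m.sigmaBar_pos
  positivity

lemma Medium.tensionCoupling_eq (hT : 0 < T) (hM : 0 < M) (hV : 0 < V) :
    m.tensionCoupling T M V = 2 * (m.sigma + m.sigmaBar * m.ratio T M V ^ 4) /
      (m.rhoL * m.rTilde T M V * m.rEq T M V ^ 2) := by
  have hR := m.rEq_pos hT hM hV
  have hRo := m.rOutEq_pos hT hM hV
  have hRt := m.rTilde_pos hT hM hV
  have hl := m.rhoL_pos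
  rw [Medium.tensionCoupling, Medium.ratio]
  field_simp

lemma Medium.tensionCoupling_pos (hT : 0 < T) (hM : 0 < M) (hV : 0 < V) :
    0 < m.tensionCoupling T M V := by
  have hR := m.rEq_pos hT hM hV
  have hRt := m.rTilde_pos hT hM hV
  have hl := m.rhoL_pos
  have := m.tension_four_pos hT hM hV
  rw [m.tensionCoupling_eq hT hM hV]
  positivity

lemma Medium.massCoupling_pos (hT : 0 < T) (hM : 0 < M) (hV : 0 < V) :
    0 < m.massCoupling T M V := by
  have := m.rEq_pos hT hM hV
  have := m.rhoEq_pos hT hM hV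
  have := m.one_lt_gamma
  unfold Medium.massCoupling
  positivity

lemma Medium.charInertia_pos (hT : 0 < T) (hM : 0 < M) (hV : 0 < V) :
    0 < m.charInertia T M V :=
  div_pos (pow_pos (m.kappaBar_pos hT hM hV) 2) (m.tensionCoupling_pos hT hM hV)

lemma Medium.charVisc_nonneg (hT : 0 < T) (hM : 0 < M) (hV : 0 < V) :
    0 ≤ m.charVisc T M V := by
  have := m.rEq_pos hT hM hV
  have := m.rTilde_pos hT hM hV
  have := m.rhoL_pos
  have := m.muL_pos
  have := volBar_pos hV
  have := m.kappaBar_pos hT hM hV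
  have := m.tensionCoupling_pos hT hM hV
  unfold Medium.charVisc Medium.damping
  positivity

/-- The small factor `1 - q` comes from `R̃ = R (1 - q)`: a thin liquid layer has little inertia. -/
lemma Medium.charInertia_eq (hT : 0 < T) (hM : 0 < M) (hV : 0 < V) :
    m.charInertia T M V = m.kappaBar T M V ^ 2 * m.rhoL * m.rEq T M V ^ 3 *
      (1 - m.ratio T M V) / (2 * (m.sigma + m.sigmaBar * m.ratio T M V ^ 4)) := by
  have := m.rEq_pos hT hM hV
  have := sub_pos.2 (m.ratio_lt_one hT hM hV)
  have := m.rhoL_pos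
  have := m.tension_four_pos hT hM hV
  rw [Medium.charInertia, m.tensionCoupling_eq hT hM hV, m.rTilde_eq]
  field_simp

/-- Here `R̃` cancels, and the smallness comes from `V̄ / (R³ + V̄) = 1 - q³` instead. -/
lemma Medium.charVisc_eq (hT : 0 < T) (hM : 0 < M) (hV : 0 < V) :
    m.charVisc T M V = 2 * m.muL * m.kappaBar T M V * m.rEq T M V *
      (1 - m.ratio T M V ^ 3) / (m.sigma + m.sigmaBar * m.ratio T M V ^ 4) := by
  have := m.rEq_pos hT hM hV
  have := sub_pos.2 (m.ratio_lt_one hT hM hV)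
  have := m.rhoL_pos
  have := volBar_pos hV
  have := m.tension_four_pos hT hM hV
  rw [Medium.charVisc, m.tensionCoupling_eq hT hM hV, m.rTilde_eq, Medium.damping, m.rTilde_eq,
    m.one_sub_ratio_cube hT hM hV]
  field_simp
  ring

lemma Medium.charPressure_eq (hT : 0 < T) (hM : 0 < M) (hV : 0 < V) :
    m.charPressure T M V = 3 * m.gamma * (m.sigma + m.sigmaBar * m.ratio T M V) /
      (m.sigma + m.sigmaBar * m.ratio T M V ^ 4) := by
  have := m.rEq_pos hT hM hV
  have := m.rTilde_pos hT hM hV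
  have := m.rhoL_pos
  have := m.rGas_pos
  have := m.tension_four_pos hT hM hV
  rw [Medium.charPressure, m.tensionCoupling_eq hT hM hV, Medium.pressureCoupling,
    Medium.massCoupling, m.rhoEq_eq hT hM hV]
  field_simp

/-- `q⁴ ≤ q` for `0 < q < 1`. That `A` approaches `3 γ` from above keeps the exclusion of roots
one-sided. -/
lemma Medium.le_charPressure (hT : 0 < T) (hM : 0 < M) (hV : 0 < V) :
    3 * m.gamma ≤ m.charPressure T M V := by
  have hq := m.ratio_pos hT hM hV
  have hq1 := m.ratio_lt_one hT hM hV
  have := m.sigmaBar_pos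
  have := m.one_lt_gamma
  rw [m.charPressure_eq hT hM hV, le_div_iff₀ (m.tension_four_pos hT hM hV)]
  have h4 : m.ratio T M V ^ 4 ≤ m.ratio T M V := by
    have := pow_le_pow_of_le_one hq.le hq1.le (show 1 ≤ 4 by norm_num)
    simpa using this
  gcongr

lemma Medium.tendsto_tension_four (hT : 0 < T) (hM : 0 < M) :
    Tendsto (fun V => m.sigma + m.sigmaBar * m.ratio T M V ^ 4) (𝓝[>] 0)
      (𝓝 (m.sigma + m.sigmaBar * 1 ^ 4)) :=
  (((m.tendsto_ratio hT hM).pow 4).const_mul _).const_add _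

lemma Medium.tendsto_charInertia (hT : 0 < T) (hM : 0 < M) :
    Tendsto (fun V => m.charInertia T M V) (𝓝[>] 0) (𝓝 0) := by
  have hσ := m.sigma_pos
  have hσ' := m.sigmaBar_pos
  obtain ⟨r, hr⟩ := m.tendsto_rEq hT hM
  have h := ((((m.tendsto_kappaBar hT hM).pow 2).mul_const m.rhoL).mul (hr.pow 3)).mul
    ((m.tendsto_ratio hT hM).const_sub 1)
  have h2 := h.div ((m.tendsto_tension_four hT hM).const_mul 2) (by positivity)
  simp only [sub_self, mul_zero, zero_div] at h2
  refine h2.congr' ?_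
  filter_upwards [self_mem_nhdsWithin] with V hV
  exact (m.charInertia_eq hT hM hV).symm

lemma Medium.tendsto_charVisc (hT : 0 < T) (hM : 0 < M) :
    Tendsto (fun V => m.charVisc T M V) (𝓝[>] 0) (𝓝 0) := by
  have hσ := m.sigma_pos
  have hσ' := m.sigmaBar_pos
  obtain ⟨r, hr⟩ := m.tendsto_rEq hT hM
  have h := (((m.tendsto_kappaBar hT hM).const_mul (2 * m.muL)).mul hr).mul
    (((m.tendsto_ratio hT hM).pow 3).const_sub 1)
  have h2 := h.div (m.tendsto_tension_four hT hM) (by positivity)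
  simp only [one_pow, sub_self, mul_zero, zero_div] at h2
  refine h2.congr' ?_
  filter_upwards [self_mem_nhdsWithin] with V hV
  exact (m.charVisc_eq hT hM hV).symm

lemma Medium.tendsto_charPressure (hT : 0 < T) (hM : 0 < M) :
    Tendsto (fun V => m.charPressure T M V) (𝓝[>] 0) (𝓝 (3 * m.gamma)) := by
  have hσ := m.sigma_pos
  have hσ' := m.sigmaBar_pos
  have h := (((m.tendsto_ratio hT hM).const_mul m.sigmaBar).const_add m.sigma).const_mul
    (3 * m.gamma)
  have h2 := h.div (m.tendsto_tension_four hT hM) (by positivity)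
  have h3 : 3 * m.gamma * (m.sigma + m.sigmaBar * 1) / (m.sigma + m.sigmaBar * 1 ^ 4) =
      3 * m.gamma := by
    field_simp
  rw [h3] at h2
  refine h2.congr' ?_
  filter_upwards [self_mem_nhdsWithin] with V hV
  exact (m.charPressure_eq hT hM hV).symm

/-! ### The spectrum to the right of the first Dirichlet eigenvalue -/

lemma Medium.linOp_eq (m : Medium) (T M V : ℝ) :
    m.linOp T M V = matrixOperator (bubbleMatrix (m.massCoupling T M V)
      (m.pressureCoupling T M V) (m.tensionCoupling T M V) (m.damping T M V)
      (fun n => (m.coeff n : ℂ)) (fun n => (m.omega T M V n : ℂ))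
      (fun n => ((m.kappaBar T M V * eigval n : ℝ) : ℂ))) := by
  unfold Medium.linOp
  congr 1
  funext i j
  rcases i with i | n <;> rcases j with j | l
  · fin_cases i <;> fin_cases j <;>
      simp [Medium.entry, bubbleMatrix, Medium.massCoupling, Medium.pressureCoupling,
        Medium.tensionCoupling, Medium.damping]
    ring
  · fin_cases i <;> simp [Medium.entry, bubbleMatrix, Medium.massCoupling]
  · fin_cases j <;> simp [Medium.entry, bubbleMatrix, Medium.massCoupling]
  · by_cases h : n = l <;> simp [Medium.entry, bubbleMatrix, Medium.massCoupling, h]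

/-- The signs square to one, the factors `k` and `1 / k` cancel, and `√(π/2) · 2√2 = 2√π`. Hence `a
g` is `6 (γ - 1)` times the plain sum `dirichletSum`. -/
lemma Medium.massCoupling_mul (hT : 0 < T) (hM : 0 < M) (hV : 0 < V) (n : ℕ) :
    m.massCoupling T M V * (m.omega T M V n * m.coeff n) =
      6 * (m.gamma - 1) * m.kappaBar T M V := by
  have hR := m.rEq_pos hT hM hV
  have hρ := m.rhoEq_pos hT hM hV
  have hγ : 0 < m.gamma := zero_lt_one.trans m.one_lt_gamma
  have hπ := Real.pi_pos
  have h1 : √(Real.pi / 2) * (2 * √2) = 2 * √Real.pi := by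
    rw [Real.sqrt_div' _ (by norm_num)]
    field_simp
  have h2 : ((-1 : ℝ) ^ n) ^ 2 = 1 := by rw [← pow_mul, mul_comm, pow_mul]; norm_num
  have h3 : m.omega T M V n * m.coeff n =
      2 * m.rEq T M V * m.kappaBar T M V * (m.gamma - 1) / (m.rhoEq T M V * m.gamma) := by
    have h4 : m.omega T M V n * m.coeff n =
        m.rEq T M V * m.kappaBar T M V / m.rhoEq T M V * (√(Real.pi / 2) * (2 * √2)) *
          ((-1) ^ n) ^ 2 * (m.gamma - 1) / (√Real.pi * m.gamma) := by
      unfold Medium.omega Medium.coeff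
      have : (n : ℝ) + 1 ≠ 0 := by positivity
      rw [pow_succ]
      field_simp
    rw [h4, h1, h2]
    field_simp
  rw [h3, Medium.massCoupling]
  field_simp
  ring

/-- Families decaying like `1 / (n + 1)` are square summable. -/
lemma memℓp_two_of_le {f : ℕ → ℂ} {C : ℝ} (h : ∀ n, ‖f n‖ ≤ C * ((n : ℝ) + 1)⁻¹) :
    Memℓp f 2 := by
  refine memℓp_gen ?_
  have h2 : (2 : ENNReal).toReal = (2 : ℕ) := by norm_num
  simp only [h2, Real.rpow_natCast]
  refine Summable.of_nonneg_of_le (fun n => by positivity) (fun n => ?_)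
    (summable_inv_succ_sq.mul_left (C ^ 2))
  rw [← inv_pow, ← mul_pow]
  exact pow_le_pow_left₀ (norm_nonneg _) (h n) 2

lemma Medium.norm_coeff (m : Medium) (n : ℕ) :
    ‖(m.coeff n : ℂ)‖ = |2 * √2 * (m.gamma - 1) / (√Real.pi * m.gamma)| * ((n : ℝ) + 1)⁻¹ := by
  have h : m.coeff n =
      (-1) ^ n * (2 * √2 * (m.gamma - 1) / (√Real.pi * m.gamma)) * ((n : ℝ) + 1)⁻¹ := by
    unfold Medium.coeff
    rw [mul_comm (√Real.pi * m.gamma), ← div_div]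
    ring
  rw [Complex.norm_real, Real.norm_eq_abs, h, abs_mul, abs_mul, abs_neg_one_pow, one_mul,
    abs_of_pos (show 0 < ((n : ℝ) + 1)⁻¹ by positivity)]

lemma Medium.norm_omega (m : Medium) (T M V : ℝ) (n : ℕ) :
    ‖(m.omega T M V n : ℂ)‖ =
      |-(m.rEq T M V * m.kappaBar T M V / m.rhoEq T M V) * √(Real.pi / 2)| * ((n : ℝ) + 1) := by
  rw [Complex.norm_real, Real.norm_eq_abs, Medium.omega, abs_mul, abs_mul, abs_neg_one_pow,
    mul_one, abs_of_pos (show 0 < (n : ℝ) + 1 by positivity)]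

/-- To the right of the first Dirichlet eigenvalue the nonzero spectrum is the zero set of the
characteristic function. -/
theorem Medium.mem_opSpectrum_iff (hT : 0 < T) (hM : 0 < M) (hV : 0 < V) {x : ℂ} (hx0 : x ≠ 0)
    (hx : -Real.pi ^ 2 < x.re) :
    (m.kappaBar T M V * x : ℂ) ∈ opSpectrum (m.linOp T M V) ↔
      thermal m.gamma x * (1 - m.charVisc T M V * x - m.charInertia T M V * x ^ 2) =
        m.charPressure T M V := by
  have hk := m.kappaBar_pos hT hM hV
  have hkC : (m.kappaBar T M V : ℂ) ≠ 0 := Complex.ofReal_ne_zero.2 hk.ne'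
  have hb := m.tensionCoupling_pos hT hM hV
  have hbC : (m.tensionCoupling T M V : ℂ) ≠ 0 := Complex.ofReal_ne_zero.2 hb.ne'
  have ha : (m.massCoupling T M V : ℂ) ≠ 0 :=
    Complex.ofReal_ne_zero.2 (m.massCoupling_pos hT hM hV).ne'
  set lam : ℂ := m.kappaBar T M V * x with hlamdef
  have hlam : lam ≠ 0 := mul_ne_zero hkC hx0
  set d : ℕ → ℂ := fun n => ((m.kappaBar T M V * eigval n : ℝ) : ℂ) with hd
  have hdl : ∀ n, d n + lam = m.kappaBar T M V * (eigval n + x) := by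
    intro n; simp [hd, hlamdef]; ring
  have hne : ∀ n, d n + lam ≠ 0 := fun n => by
    rw [hdl]; exact mul_ne_zero hkC (eigval_add_ne_zero hx n)
  set q : ℝ := min (Real.pi ^ 2) (Real.pi ^ 2 + x.re) with hq
  have hq0 : 0 < q := lt_min (by positivity) (by linarith)
  -- Decay of order `k⁻²` is what compensates `ωₖ ~ k`: the quotient is of order `1 / k` and hence
  -- square summable.
  have hinv : ∀ n, ‖(d n + lam)⁻¹‖ ≤ (m.kappaBar T M V * q)⁻¹ * (((n : ℝ) + 1) ^ 2)⁻¹ := by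
    intro n
    rw [hdl, mul_inv, norm_mul, norm_inv, Complex.norm_real, Real.norm_of_nonneg hk.le, mul_inv,
      mul_assoc, ← mul_inv q]
    refine mul_le_mul_of_nonneg_left ?_ (by positivity)
    exact (norm_inv_eigval_add_le hx n).trans (inv_anti₀ (by positivity) (le_eigval_add n))
  have hle1 : ∀ n : ℕ, ((n : ℝ) + 1)⁻¹ ≤ 1 := fun n => inv_le_one_of_one_le₀ (by simp)
  have hinv1 : ∀ n, ‖(d n + lam)⁻¹‖ ≤ (m.kappaBar T M V * q)⁻¹ := by
    intro n
    refine (hinv n).trans (mul_le_of_le_one_right (by positivity) ?_)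
    rw [← inv_pow]
    exact pow_le_one₀ (by positivity) (hle1 n)
  have he : Memℓp (fun n => (m.coeff n : ℂ) / (d n + lam)) 2 := by
    refine memℓp_two_of_le (C := |2 * √2 * (m.gamma - 1) / (√Real.pi * m.gamma)| *
      (m.kappaBar T M V * q)⁻¹) fun n => ?_
    rw [div_eq_mul_inv, norm_mul, m.norm_coeff]
    have := mul_le_mul_of_nonneg_left (hinv1 n)
      (show 0 ≤ |2 * √2 * (m.gamma - 1) / (√Real.pi * m.gamma)| * ((n : ℝ) + 1)⁻¹ by positivity)
    linarith
  have hh : Memℓp (fun n => (m.omega T M V n : ℂ) / (d n + lam)) 2 := by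
    refine memℓp_two_of_le (C := |-(m.rEq T M V * m.kappaBar T M V / m.rhoEq T M V) *
      √(Real.pi / 2)| * (m.kappaBar T M V * q)⁻¹) fun n => ?_
    rw [div_eq_mul_inv, norm_mul, m.norm_omega]
    refine (mul_le_mul_of_nonneg_left (hinv n) (by positivity)).trans (le_of_eq ?_)
    have : (n : ℝ) + 1 ≠ 0 := by positivity
    field_simp
  have hg : HasSum (fun n => (m.omega T M V n : ℂ) * ((m.coeff n : ℂ) / (d n + lam)))
      ((m.massCoupling T M V : ℂ)⁻¹ * (6 * ((m.gamma : ℂ) - 1)) * dirichletSum x) := by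
    refine ((summable_dirichletSum hx).hasSum.mul_left
      ((m.massCoupling T M V : ℂ)⁻¹ * (6 * ((m.gamma : ℂ) - 1)))).congr_fun fun n => ?_
    have h1 : (m.massCoupling T M V : ℂ) * (m.omega T M V n * m.coeff n) =
      6 * (m.gamma - 1) * m.kappaBar T M V := by exact_mod_cast m.massCoupling_mul hT hM hV n
    have h2 := eigval_add_ne_zero hx n
    rw [hdl]
    field_simp
    linear_combination h1
  have hG : 1 + (m.massCoupling T M V : ℂ) *
      ((m.massCoupling T M V : ℂ)⁻¹ * (6 * ((m.gamma : ℂ) - 1)) * dirichletSum x) =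
      thermal m.gamma x := by
    rw [thermal]
    field_simp
  have hF : thermal m.gamma x *
        (m.tensionCoupling T M V - m.damping T M V * lam - lam ^ 2) -
        m.pressureCoupling T M V * m.massCoupling T M V =
      m.tensionCoupling T M V * (thermal m.gamma x *
        (1 - m.charVisc T M V * x - m.charInertia T M V * x ^ 2) - m.charPressure T M V) := by
    simp only [Medium.charVisc, Medium.charInertia, Medium.charPressure, hlamdef]
    push_cast
    field_simp
  have hmain : (m.kappaBar T M V * x : ℂ) ∈ opSpectrum (m.linOp T M V) ↔
      ¬ IsResolventPoint (m.linOp T M V) lam := Iff.rfl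
  rw [← hlamdef] at hmain
  rw [hmain, m.linOp_eq]
  constructor
  · intro h
    by_contra hne'
    refine h (isResolventPoint_bubble ha hlam hinv1 hne he hh hg ?_ ?_)
    · rw [hG]; exact thermal_ne_zero m.one_lt_gamma hx
    · rw [hG, hF]; exact mul_ne_zero hbC (sub_ne_zero.2 hne')
  · intro h
    refine not_isResolventPoint_bubble ha hlam hne he hg ?_
    rw [hG, hF, h, sub_self, mul_zero]

/-! ### The spectral bound -/

/-- For small liquid volumes the spectral bound divided by `κ̄` is close to the solution `u` of the
limiting characteristic equation. -/
theorem Medium.eventually_spectralBound (hT : 0 < T) (hM : 0 < M) {u η : ℝ}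
    (hu : thermalReal m.gamma u = 3 * m.gamma) (hη : 0 < η) (hlow : -Real.pi ^ 2 < u - η)
    (hupp : u + η ≤ 0) :
    ∀ᶠ V in 𝓝[>] 0, (m.reSpectrum T M V).Nonempty ∧ BddAbove (m.reSpectrum T M V) ∧
      m.kappaBar T M V * (u - η) < sSup (m.reSpectrum T M V) ∧
      sSup (m.reSpectrum T M V) ≤ m.kappaBar T M V * (u + η) := by
  have hγ := m.one_lt_gamma
  have hanti := strictAntiOn_thermalReal hγ
  -- Strict monotonicity puts `thermalReal` below `3 γ` at `u + η` and above it at `u - η`: no root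
  -- has `Re x ≥ u + η`, and a real one lies in `(u - η, 0)`.
  obtain ⟨ε₁, hε₁, h1⟩ := exists_forall_characteristic_ne hγ (β := -(u + η)) (by linarith)
    (by linarith) (by
      rw [← hu]
      exact hanti (show -Real.pi ^ 2 < u by linarith)
        (show -Real.pi ^ 2 < - -(u + η) by linarith) (by linarith))
  obtain ⟨ε₂, hε₂, h2⟩ := exists_forall_characteristic_root hγ (b := u - η) hlow (by linarith) (by
      rw [← hu]
      exact hanti hlow (show -Real.pi ^ 2 < u by linarith) (by linarith))
  filter_upwards [self_mem_nhdsWithin,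
    (m.tendsto_charInertia hT hM).eventually_lt_const (lt_min hε₁ hε₂),
    (m.tendsto_charVisc hT hM).eventually_lt_const hε₁,
    (m.tendsto_charPressure hT hM).eventually_lt_const
      (show 3 * m.gamma < 3 * m.gamma + min 1 ε₂ from lt_add_of_pos_right _ (lt_min one_pos hε₂))]
    with V hV hI hD hP
  have hV : 0 < V := hV
  have hk := m.kappaBar_pos hT hM hV
  have hkC : (m.kappaBar T M V : ℂ) ≠ 0 := Complex.ofReal_ne_zero.2 hk.ne'
  have hP1 := min_le_left 1 ε₂
  have hP2 := min_le_right 1 ε₂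
  have hupper : ∀ s ∈ m.reSpectrum T M V, s ≤ m.kappaBar T M V * (u + η) := by
    rintro s ⟨lam, ⟨hlam, hlam0⟩, rfl⟩
    by_contra hcon
    rw [not_le] at hcon
    obtain ⟨x, rfl⟩ : ∃ x : ℂ, lam = m.kappaBar T M V * x :=
      ⟨lam / m.kappaBar T M V, by field_simp⟩
    rw [Complex.re_ofReal_mul] at hcon
    have hx := lt_of_mul_lt_mul_left hcon hk.le
    have hx0 : x ≠ 0 := by rintro rfl; simp at hlam0
    rw [m.mem_opSpectrum_iff hT hM hV hx0 (by linarith)] at hlam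
    exact h1 _ _ _ (m.charInertia_pos hT hM hV) (hI.trans_le (min_le_left _ _))
      (m.charVisc_nonneg hT hM hV) hD (m.le_charPressure hT hM hV) (by linarith) x
      (by linarith) hlam
  obtain ⟨y, hy1, hy2, hy3⟩ := h2 _ _ _ (m.charInertia_pos hT hM hV)
    (hI.trans_le (min_le_right _ _)) (m.charVisc_nonneg hT hM hV) (m.le_charPressure hT hM hV)
    (hP.trans_le (by linarith))
  have hy0 : (y : ℂ) ≠ 0 := Complex.ofReal_ne_zero.2 hy2.ne
  have hroot : m.kappaBar T M V * y ∈ m.reSpectrum T M V := by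
    refine ⟨m.kappaBar T M V * (y : ℂ), ⟨?_, by simpa using ⟨hk.ne', hy2.ne⟩⟩, by simp⟩
    rw [m.mem_opSpectrum_iff hT hM hV hy0 (by simpa using hlow.trans hy1), thermal_ofReal]
    exact_mod_cast hy3
  have hbdd : BddAbove (m.reSpectrum T M V) := ⟨_, hupper⟩
  exact ⟨⟨_, hroot⟩, hbdd, (mul_lt_mul_of_pos_left hy1 hk).trans_le (le_csSup hbdd hroot),
    csSup_le ⟨_, hroot⟩ hupper⟩

lemma exists_of_eventually_nhdsGT {p : ℝ → Prop} (h : ∀ᶠ V in 𝓝[>] (0 : ℝ), p V) :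
    ∃ V₀ : ℝ, 0 < V₀ ∧ ∀ V : ℝ, 0 < V → V < V₀ → p V := by
  obtain ⟨V₀, hV₀, h⟩ := mem_nhdsGT_iff_exists_Ioo_subset.1 h
  exact ⟨V₀, hV₀, fun V h0 h1 => h ⟨h0, h1⟩⟩

/-- The limiting value of `κ̄` grows with the temperature and decreases with the gas mass. -/
lemma Medium.kappaOfRatio_one_lt {T' M' : ℝ} (hT : 0 < T) (hM' : 0 < M') (hTT : T ≤ T')
    (hMM : M' ≤ M) (h : T < T' ∨ M' < M) :
    m.kappaOfRatio T M 1 < m.kappaOfRatio T' M' 1 := by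
  have hk := m.kTh_pos
  have hc := m.cHeat_pos
  have hg := m.rGas_pos
  have hγ : 0 < m.gamma := zero_lt_one.trans m.one_lt_gamma
  have hσ := m.sigma_pos
  have hσ' := m.sigmaBar_pos
  have hπ := Real.pi_pos
  have hM : 0 < M := hM'.trans_le hMM
  have h1 : T / M < T' / M' := by
    rw [div_lt_div_iff₀ hM hM']
    rcases h with h | h <;> nlinarith
  unfold Medium.kappaOfRatio
  gcongr

end BubbleSpectrum

end

/-! ### ### The three assertions from the spectral bound -/

theorem mainTheorem5 (m : BubbleSpectrum.Medium) :
    -- two-sided bound for the supremum, with one `Θ₀` for all temperatures and masses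
    (∃ Θ₀ : ℝ, 0 < Θ₀ ∧ Θ₀ < 1 ∧
      ∀ T M : ℝ, 0 < T → 0 < M →
        ∃ V₀ : ℝ, 0 < V₀ ∧ ∀ V : ℝ, 0 < V → V < V₀ →
          (m.reSpectrum T M V).Nonempty ∧ BddAbove (m.reSpectrum T M V) ∧
          -(Real.pi ^ 2 * m.kappaBar T M V) < sSup (m.reSpectrum T M V) ∧
          sSup (m.reSpectrum T M V) ≤ -(Θ₀ * (Real.pi ^ 2 * m.kappaBar T M V))) ∧
    -- `π² κ̄` is comparable to `√(T / M)`
    (∀ T M V : ℝ, 0 < T → 0 < M → 0 < V →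
      m.kTh * Real.pi ^ 2 / (m.gamma * m.cHeat) *
            Real.sqrt (2 * Real.pi * m.rGas / (3 * m.sigma)) *
            (Real.sqrt (T / M) / Real.sqrt (1 + m.sigmaBar / m.sigma))
          < Real.pi ^ 2 * m.kappaBar T M V ∧
      Real.pi ^ 2 * m.kappaBar T M V
          < m.kTh * Real.pi ^ 2 / (m.gamma * m.cHeat) *
            Real.sqrt (2 * Real.pi * m.rGas / (3 * m.sigma)) * Real.sqrt (T / M)) ∧
    -- a smaller gas mass or a higher temperature makes the decay faster
    (∀ T T' M M' : ℝ, 0 < T → 0 < M' → T ≤ T' → M' ≤ M → (T < T' ∨ M' < M) →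
      ∃ V₀ : ℝ, 0 < V₀ ∧ ∀ V : ℝ, 0 < V → V < V₀ →
        sSup (m.reSpectrum T' M' V) < sSup (m.reSpectrum T M V)) := by
  open BubbleSpectrum Filter Topology in
  obtain ⟨u, hu1, hu0, hu⟩ := exists_thermalReal_eq m.one_lt_gamma
  -- Chosen so that `u + η₀ ≤ u / 2` and `u - η₀ > -π²`. The first gives `Θ₀ = -u / (2 π²)`, which
  -- depends only on `γ` because `u` does.
  set η₀ : ℝ := min (-u / 2) ((u + Real.pi ^ 2) / 2) with hη₀def
  have hη₀ : 0 < η₀ := lt_min (by linarith) (by linarith)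
  have hη₁ : η₀ ≤ -u / 2 := min_le_left _ _
  have hη₂ : η₀ ≤ (u + Real.pi ^ 2) / 2 := min_le_right _ _
  have hπ : 0 < Real.pi ^ 2 := by positivity
  refine ⟨⟨-u / (2 * Real.pi ^ 2), div_pos (by linarith) (by positivity), ?_, ?_⟩, ?_, ?_⟩
  · rw [div_lt_one (by positivity)]
    linarith
  · intro T M hT hM
    refine exists_of_eventually_nhdsGT ?_
    filter_upwards [self_mem_nhdsWithin, m.eventually_spectralBound hT hM hu hη₀ (by linarith)
      (by linarith)] with V hV hs
    obtain ⟨h1, h2, h3, h4⟩ := hs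
    have hk := m.kappaBar_pos hT hM hV
    refine ⟨h1, h2, ?_, ?_⟩
    · refine lt_trans ?_ h3
      have := mul_lt_mul_of_pos_left (show -Real.pi ^ 2 < u - η₀ by linarith) hk
      linarith
    · refine h4.trans ?_
      have h5 : -(-u / (2 * Real.pi ^ 2) * (Real.pi ^ 2 * m.kappaBar T M V)) =
          m.kappaBar T M V * (u / 2) := by
        field_simp
      rw [h5]
      exact mul_le_mul_of_nonneg_left (by linarith) hk.le
  · intro T M V hT hM hV
    -- The two bounds are the values of `κ̄` at `q = 0` and `q = 1`.
    have h0 := m.kappaOfRatio_lt hT hM le_rfl (m.ratio_pos hT hM hV)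
    have h1 := m.kappaOfRatio_lt hT hM (m.ratio_pos hT hM hV).le (m.ratio_lt_one hT hM hV)
    rw [← m.kappaBar_eq hT hM hV] at h0 h1
    have e0 := mul_lt_mul_of_pos_left h0 hπ
    have e1 := mul_lt_mul_of_pos_left h1 hπ
    simp only [Medium.kappaOfRatio, mul_zero, add_zero, Real.sqrt_one, div_one, mul_one] at e0 e1
    constructor
    · exact lt_of_eq_of_lt (by ring) e1
    · exact lt_of_lt_of_eq e0 (by ring)
  · intro T T' M M' hT hM' hTT hMM h
    have hT' : 0 < T' := hT.trans_le hTT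
    have hM : 0 < M := hM'.trans_le hMM
    have hlt := m.kappaOfRatio_one_lt hT hM' hTT hMM h
    have hpos : 0 ≤ m.kappaOfRatio T M 1 :=
      ge_of_tendsto (m.tendsto_kappaBar hT hM) (by
        filter_upwards [self_mem_nhdsWithin] with V hV
        exact (m.kappaBar_pos hT hM hV).le)
    set k := m.kappaOfRatio T M 1
    set k' := m.kappaOfRatio T' M' 1
    -- The wanted `k' (u + η) < k (u - η)` amounts to `η (k' + k) < -u (k' - k)`; half of the
    -- critical value is taken.
    set η : ℝ := min η₀ (-u * (k' - k) / (2 * (k' + k))) with hηdef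
    have hu' : 0 < -u := by linarith
    have hk' : 0 < k' - k := by linarith
    have hkk : 0 < k' + k := by linarith
    have hη : 0 < η := lt_min hη₀ (by positivity)
    have hηle : η ≤ η₀ := min_le_left _ _
    have hηk : η * (2 * (k' + k)) ≤ -u * (k' - k) :=
      (le_div_iff₀ (by positivity)).1 (min_le_right _ _)
    have hlim : k' * (u + η) < k * (u - η) := by nlinarith [mul_pos hu' hk']
    -- Both spectral bounds are governed by the same `u`, so `s' ≤ κ̄' (u + η) < κ̄ (u - η) < s` for
    -- small `V`.
    refine exists_of_eventually_nhdsGT ?_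
    filter_upwards [m.eventually_spectralBound hT hM hu hη (by linarith) (by linarith),
      m.eventually_spectralBound hT' hM' hu hη (by linarith) (by linarith),
      ((m.tendsto_kappaBar hT' hM').mul_const (u + η)).eventually_lt
        ((m.tendsto_kappaBar hT hM).mul_const (u - η)) hlim]
      with V h1 h2 h3
    exact (h2.2.2.2.trans_lt h3).trans h1.2.2.1
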